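/- Let $d\ge 2$ and let $\mathfrak j\in\mathbb R$, $\mathfrak j\neq 0$. Put $V_0(x)=\mathfrak j\,x_1$ for $x=(x_1,\dots,x_d)\in\mathbb R^d$, and let $\mathcal A_0=-\Delta+iV_0$ be the unbounded operator on the complex Hilbert space $L^2(\mathbb R^d)$ with domain $D(\mathcal A_0)=\{u\in H^2(\mathbb R^d): V_0u\in L^2(\mathbb R^d)\}$, where $\Delta$ is the distributional Laplacian. Then $\mathcal A_0+1:D(\mathcal A_0)\to L^2(\mathbb R^d)$ is bijective, its inverse $A=(\mathcal A_0+1)^{-1}$ is a bounded operator on $L^2(\mathbb R^d)$, the spectrum of $A$ is $\sigma(A)=\{0\}$, and $A$ is not a compact operator. -/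

import Mathlib

open MeasureTheory

open scoped SchwartzMap Laplacian

noncomputable section

namespace BlochTorrey

/-- Euclidean space `ℝ^d`. -/
abbrev Space (d : ℕ) : Type := EuclideanSpace ℝ (Fin d)

/-- The complex Hilbert space `L²(ℝ^d)`. -/
abbrev L2 (d : ℕ) : Type := Lp ℂ 2 (volume : Measure (Space d))

/-- The Sobolev space `H²(ℝ^d)`, as a subspace of `L²(ℝ^d)`. -/
def sobolevH2 (d : ℕ) : Submodule ℂ (L2 d) where
  carrier := {u | TemperedDistribution.MemSobolev 2 2 (u : 𝓢'(Space d, ℂ))}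
  add_mem' {u v} hu hv := by
    have h := TemperedDistribution.MemSobolev.add hu hv
    simp only [Set.mem_ofPred_eq]
    rwa [← Lp.toTemperedDistributionCLM_apply, map_add]
  zero_mem' := by
    simp only [Set.mem_ofPred_eq]
    rw [← Lp.toTemperedDistributionCLM_apply, map_zero]
    exact TemperedDistribution.memSobolev_fun_zero _ _ 2 2
  smul_mem' c u hu := by
    have h := TemperedDistribution.MemSobolev.smul c hu
    simp only [Set.mem_ofPred_eq]
    rwa [← Lp.toTemperedDistributionCLM_apply, map_smul]

/-- For `u ∈ H²(ℝ^d)` the distributional Laplacian of `u` is an `L²` function. -/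
theorem exists_laplacian_eq {d : ℕ} (u : sobolevH2 d) :
    ∃ f : L2 d, Δ ((u : L2 d) : 𝓢'(Space d, ℂ)) = (f : 𝓢'(Space d, ℂ)) := by
  have h := TemperedDistribution.MemSobolev.laplacian (show TemperedDistribution.MemSobolev 2 2
    ((u : L2 d) : 𝓢'(Space d, ℂ)) from u.2)
  rw [sub_self, TemperedDistribution.memSobolev_zero_iff] at h
  exact h

/-- An `L²` function is determined by the tempered distribution it defines. -/
theorem toTemperedDistribution_injective {d : ℕ} {f g : L2 d}
    (h : (f : 𝓢'(Space d, ℂ)) = (g : 𝓢'(Space d, ℂ))) : f = g :=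
  LinearMap.ker_eq_bot.mp
    (Lp.ker_toTemperedDistributionCLM_eq_bot (E := Space d) (F := ℂ) (μ := volume) (p := 2)) h

/-- The distributional Laplacian of `u ∈ H²(ℝ^d)`, as an element of `L²(ℝ^d)`. -/
def laplacianFun {d : ℕ} (u : sobolevH2 d) : L2 d := (exists_laplacian_eq u).choose

theorem laplacianFun_spec {d : ℕ} (u : sobolevH2 d) :
    (laplacianFun u : 𝓢'(Space d, ℂ)) = Δ ((u : L2 d) : 𝓢'(Space d, ℂ)) :=
  (exists_laplacian_eq u).choose_spec.symm

/-- The Laplacian `Δ`, in the sense of distributions, as an unbounded operator on `L²(ℝ^d)` with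
domain `H²(ℝ^d)`. -/
def laplacianOp (d : ℕ) : L2 d →ₗ.[ℂ] L2 d where
  domain := sobolevH2 d
  toFun :=
    { toFun := laplacianFun
      map_add' := fun u v ↦ by
        apply toTemperedDistribution_injective
        rw [laplacianFun_spec, ← Lp.toTemperedDistributionCLM_apply,
          ← Lp.toTemperedDistributionCLM_apply, Submodule.coe_add, map_add, map_add,
          ← TemperedDistribution.laplacianCLM_apply, map_add]
        simp only [TemperedDistribution.laplacianCLM_apply, Lp.toTemperedDistributionCLM_apply,
          laplacianFun_spec]
      map_smul' := fun c u ↦ by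
        apply toTemperedDistribution_injective
        rw [laplacianFun_spec, ← Lp.toTemperedDistributionCLM_apply,
          ← Lp.toTemperedDistributionCLM_apply, Submodule.coe_smul, map_smul, map_smul,
          ← TemperedDistribution.laplacianCLM_apply, map_smul]
        simp only [TemperedDistribution.laplacianCLM_apply, Lp.toTemperedDistributionCLM_apply,
          laplacianFun_spec, RingHom.id_apply] }

/-- The maximal domain `{u ∈ L²(ℝ^d) : V u ∈ L²(ℝ^d)}` of multiplication by `V`. -/
def mulDomain {d : ℕ} (V : Space d → ℝ) : Submodule ℂ (L2 d) where
  carrier := {u | MemLp (fun x ↦ (V x : ℂ) * u x) 2 volume}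
  add_mem' {u v} hu hv := by
    refine (MemLp.add hu hv).ae_eq ?_
    filter_upwards [Lp.coeFn_add u v] with x hx
    simp only [hx, Pi.add_apply, mul_add]
  zero_mem' := by
    refine (MemLp.zero' (p := 2) (μ := (volume : Measure (Space d)))).ae_eq ?_
    filter_upwards [Lp.coeFn_zero ℂ 2 (volume : Measure (Space d))] with x hx
    simp only [hx, Pi.zero_apply, mul_zero]
  smul_mem' c u hu := by
    refine (MemLp.const_smul hu c).ae_eq ?_
    filter_upwards [Lp.coeFn_smul c u] with x hx
    simp only [hx, Pi.smul_apply, smul_eq_mul, mul_left_comm]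

/-- The product `V u`, as an element of `L²(ℝ^d)`. -/
def mulFun {d : ℕ} (V : Space d → ℝ) (u : mulDomain V) : L2 d :=
  MemLp.toLp (fun x ↦ (V x : ℂ) * (u : L2 d) x) u.2

theorem mulFun_spec {d : ℕ} (V : Space d → ℝ) (u : mulDomain V) :
    mulFun V u =ᵐ[volume] fun x ↦ (V x : ℂ) * (u : L2 d) x :=
  MemLp.coeFn_toLp _

/-- Multiplication by a real function `V`, as an unbounded operator on `L²(ℝ^d)` with its maximal
domain. -/
def mulOp {d : ℕ} (V : Space d → ℝ) : L2 d →ₗ.[ℂ] L2 d where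
  domain := mulDomain V
  toFun :=
    { toFun := mulFun V
      map_add' := fun u v ↦ by
        apply Lp.ext
        filter_upwards [Lp.coeFn_add (u : L2 d) (v : L2 d), Lp.coeFn_add (mulFun V u) (mulFun V v),
          mulFun_spec V u, mulFun_spec V v, mulFun_spec V (u + v)] with x h₁ h₂ h₃ h₄ h₅
        rw [h₅, h₂, Submodule.coe_add, h₁, Pi.add_apply, Pi.add_apply, h₃, h₄, mul_add]
      map_smul' := fun c u ↦ by
        apply Lp.ext
        filter_upwards [Lp.coeFn_smul c (u : L2 d), Lp.coeFn_smul c (mulFun V u),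
          mulFun_spec V u, mulFun_spec V (c • u)] with x h₁ h₂ h₃ h₄
        rw [RingHom.id_apply, h₄, h₂, Submodule.coe_smul, h₁, Pi.smul_apply, Pi.smul_apply, h₃,
          smul_eq_mul, smul_eq_mul, mul_left_comm] }

/-- The operator `-Δ + i V` on `L²(ℝ^d)`, with domain `{u ∈ H²(ℝ^d) : V u ∈ L²(ℝ^d)}`. -/
def schrodingerOp {d : ℕ} (V : Space d → ℝ) : L2 d →ₗ.[ℂ] L2 d where
  domain := sobolevH2 d ⊓ mulDomain V
  toFun :=
    -((laplacianOp d).toFun ∘ₗ Submodule.inclusion inf_le_left) +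
      Complex.I • ((mulOp V).toFun ∘ₗ Submodule.inclusion inf_le_right)

theorem mem_schrodingerOp_domain {d : ℕ} {V : Space d → ℝ} {u : L2 d} :
    u ∈ (schrodingerOp V).domain ↔
      TemperedDistribution.MemSobolev 2 2 (u : 𝓢'(Space d, ℂ)) ∧
        MemLp (fun x ↦ (V x : ℂ) * u x) 2 volume :=
  Iff.rfl

theorem schrodingerOp_apply {d : ℕ} (V : Space d → ℝ) (u : L2 d) (h₁ : u ∈ sobolevH2 d)
    (h₂ : u ∈ mulDomain V) :
    schrodingerOp V ⟨u, h₁, h₂⟩ = -laplacianFun ⟨u, h₁⟩ + Complex.I • mulFun V ⟨u, h₂⟩ :=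
  rfl

/-- The bounded operator `A` is the inverse `(T + 1)⁻¹` of `T + 1 : D(T) → H`. -/
def IsInverseAddOne {H : Type*} [NormedAddCommGroup H] [NormedSpace ℂ H]
    (T : H →ₗ.[ℂ] H) (A : H →L[ℂ] H) : Prop :=
  (∀ u : T.domain, A (T u + (u : H)) = u) ∧
    ∀ f : H, ∃ h : A f ∈ T.domain, T ⟨A f, h⟩ + A f = f

/-- There is at most one bounded inverse of `T + 1`. -/
theorem IsInverseAddOne.unique {H : Type*} [NormedAddCommGroup H] [NormedSpace ℂ H]
    {T : H →ₗ.[ℂ] H} {A B : H →L[ℂ] H} (hA : IsInverseAddOne T A) (hB : IsInverseAddOne T B) :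
    A = B := by
  ext f
  obtain ⟨h, hf⟩ := hB.2 f
  have := hA.1 ⟨B f, h⟩
  rwa [hf] at this

end BlochTorrey

end

/-! Write `𝔧 x₁ = 2π⟨x, b⟩` with `b` a multiple of the first basis vector. The Fourier transform
turns `-Δ + 2πi⟨b, x⟩` into the first order operator `4π²‖ξ‖² - b · ∇`. Solving along
characteristics, minus this operator generates the explicit semigroup `f ↦ exp(-4π² ∫₀ᵗ ‖ξ + s b‖²
ds) f(ξ + t b)`, called `evol`. The integral is at least `t³‖b‖²/12` for every `ξ`, so the semigroup
decays like `exp(-c t³)` and its Laplace transform `laplaceEvol` converges for every complex `z`.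

It inverts the generator plus `z` from the left for all `z` (`laplaceEvol_generator`, by integrating
a derivative in `t`), and from the right for `z = 1` (`exists_generator_laplaceEvol`). The latter
needs `‖ξ‖²` times the solution to be in `L²`, which is a Schur test; the equation itself then
follows by duality with the operator for `-b`. The resolvent identities make `l - A` invertible for
every `l ≠ 0`; since the spectrum of an element of a nontrivial complex Banach algebra is nonempty,
it is `{0}`.

For `w ⊥ b` the potential is invariant under translation by `w`, so on the Fourier side the
resolvent commutes with the modulations by multiples of `w`. These preserve norms and tend weakly to
zero, which excludes compactness. -/

noncomputable section

namespace BlochTorrey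

open FourierTransform Filter Set
open scoped Topology ENNReal BoundedContinuousFunction Real

variable {d : ℕ}

/-! ### Multiplications, translations and characters on `L²` -/

/-- Multiplication by a bounded continuous function on `L²`. -/
def mulBCF (φ : Space d →ᵇ ℂ) : L2 d →L[ℂ] L2 d :=
  (ContinuousLinearMap.mul ℂ ℂ).holderL volume ∞ 2 2
    ((memLp_top_of_bound φ.continuous.aestronglyMeasurable ‖φ‖
      (Eventually.of_forall φ.norm_coe_le_norm)).toLp φ)

theorem coeFn_mulBCF (φ : Space d →ᵇ ℂ) (f : L2 d) :
    mulBCF φ f =ᵐ[volume] fun x ↦ φ x * f x := by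
  have h := memLp_top_of_bound (μ := (volume : Measure (Space d)))
    φ.continuous.aestronglyMeasurable ‖φ‖ (Eventually.of_forall φ.norm_coe_le_norm)
  filter_upwards [(ContinuousLinearMap.mul ℂ ℂ).coeFn_holder (r := 2) (h.toLp φ) f,
    h.coeFn_toLp] with x h₁ h₂
  exact h₁.trans (by simp [h₂])

theorem norm_mulBCF_le {φ : Space d →ᵇ ℂ} {C : ℝ} (hC : ∀ x, ‖φ x‖ ≤ C) (f : L2 d) :
    ‖mulBCF φ f‖ ≤ C * ‖f‖ := by
  apply Lp.norm_le_mul_norm_of_ae_le_mul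
  filter_upwards [coeFn_mulBCF φ f] with x hx
  rw [hx, norm_mul]
  gcongr
  exact hC x

/-- The translation `f ↦ f (· + a)` on `L²`. -/
def translate (a : Space d) : L2 d →L[ℂ] L2 d :=
  (Lp.compMeasurePreservingₗᵢ ℂ (fun x ↦ x + a)
    (measurePreserving_add_right volume a)).toContinuousLinearMap

theorem coeFn_translate (a : Space d) (f : L2 d) :
    translate a f =ᵐ[volume] fun x ↦ f (x + a) :=
  Lp.coeFn_compMeasurePreserving f (measurePreserving_add_right volume a)

theorem norm_translate (a : Space d) (f : L2 d) : ‖translate a f‖ = ‖f‖ :=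
  Lp.norm_compMeasurePreserving f (measurePreserving_add_right volume a)

theorem continuous_translate (f : L2 d) : Continuous fun a ↦ translate a f := by
  let g : Space d → C(Space d, Space d) := fun a ↦ ⟨fun x ↦ x + a, by fun_prop⟩
  have hg : Continuous g := ContinuousMap.continuous_of_continuous_uncurry _ (by
    simp only [g, ContinuousMap.coe_mk]; fun_prop)
  exact (continuous_const (y := f)).compMeasurePreservingLp hg
    (fun a ↦ measurePreserving_add_right volume a) (by norm_num)

theorem ae_comp_add_right {p : Space d → Prop} (h : ∀ᵐ x, p x) (a : Space d) :
    ∀ᵐ x, p (x + a) :=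
  (measurePreserving_add_right volume a).quasiMeasurePreserving.ae h

theorem inner_L2_eq (f g : L2 d) : inner ℂ f g = ∫ x, g x * starRingEnd ℂ (f x) := rfl

theorem inner_translate_left (a : Space d) (f g : L2 d) :
    inner ℂ (translate a f) g = inner ℂ f (translate (-a) g) := by
  rw [inner_L2_eq, inner_L2_eq, ← integral_sub_right_eq_self _ a]
  apply integral_congr_ae
  filter_upwards [ae_comp_add_right (coeFn_translate a f) (-a), coeFn_translate (-a) g]
    with x h₁ h₂
  rw [h₂, sub_eq_add_neg, h₁, neg_add_cancel_right]

theorem inner_mulBCF_left {φ : Space d →ᵇ ℂ} (hφ : ∀ x, starRingEnd ℂ (φ x) = φ x)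
    (f g : L2 d) : inner ℂ (mulBCF φ f) g = inner ℂ f (mulBCF φ g) := by
  rw [inner_L2_eq, inner_L2_eq]
  apply integral_congr_ae
  filter_upwards [coeFn_mulBCF φ f, coeFn_mulBCF φ g] with x h₁ h₂
  rw [h₁, h₂, map_mul, hφ]
  ring

/-- The character `x ↦ exp (-2πi⟨x, a⟩)`. -/
def phase (a : Space d) : Space d →ᵇ ℂ :=
  BoundedContinuousFunction.ofNormedAddCommGroup
    (fun x ↦ Complex.exp ((-(2 * π * inner ℝ x a) : ℝ) * Complex.I))
    (by fun_prop) 1 (fun x ↦ by rw [Complex.norm_exp_ofReal_mul_I])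

theorem phase_apply (a x : Space d) :
    phase a x = Complex.exp ((-(2 * π * inner ℝ x a) : ℝ) * Complex.I) := rfl

theorem norm_phase (a x : Space d) : ‖phase a x‖ = 1 := by
  rw [phase_apply, Complex.norm_exp_ofReal_mul_I]

theorem fourierChar_smul_eq (a x : Space d) (z : ℂ) : 𝐞 (-inner ℝ x a) • z = phase a x * z := by
  rw [Circle.smul_def, Real.fourierChar_apply, phase_apply, smul_eq_mul, mul_neg]

/-! ### Passing between distributions and `L²` functions -/

/-- Two `L²` functions with the same weighted tempered distribution agree. -/
theorem ae_eq_of_smulLeftCLM_eq {φ : Space d → ℂ} (hφ : φ.HasTemperateGrowth) {w h : L2 d}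
    (H : TemperedDistribution.smulLeftCLM ℂ φ (w : 𝓢'(Space d, ℂ)) = (h : 𝓢'(Space d, ℂ))) :
    ∀ᵐ x, φ x * w x = h x := by
  have hw := (Lp.memLp w).locallyIntegrable (by norm_num)
  refine ae_eq_of_integral_contDiff_smul_eq ?_ ((Lp.memLp h).locallyIntegrable (by norm_num)) ?_
  · rw [← locallyIntegrableOn_univ] at hw ⊢
    exact hw.continuousOn_mul hφ.1.continuous.continuousOn isOpen_univ.isLocallyClosed
  · intro g hg hgc
    have hg₁ : HasCompactSupport (Complex.ofRealCLM ∘ g) := hgc.comp_left rfl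
    have hg₂ : ContDiff ℝ (⊤ : ℕ∞) (Complex.ofRealCLM ∘ g) := Complex.ofRealCLM.contDiff.comp hg
    have := congr($H (hg₁.toSchwartzMap hg₂))
    simpa [hφ, mul_assoc, mul_comm, mul_left_comm] using this

theorem smulLeftCLM_eq_of_ae_eq {φ : Space d → ℂ} (hφ : φ.HasTemperateGrowth) {w h : L2 d}
    (H : ∀ᵐ x, φ x * w x = h x) :
    TemperedDistribution.smulLeftCLM ℂ φ (w : 𝓢'(Space d, ℂ)) = (h : 𝓢'(Space d, ℂ)) := by
  ext g
  simp only [Lp.toTemperedDistribution_apply, TemperedDistribution.smulLeftCLM_apply_apply]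
  apply integral_congr_ae
  filter_upwards [H] with x hx
  rw [← hx]
  simp [hφ]
  ring

/-- Tested against Schwartz functions: the Fourier transform moves onto the test function, where the
character becomes a translation, and a change of variables carries the translation back. -/
theorem fourier_mulBCF_phase (a : Space d) (f : L2 d) :
    𝓕 (mulBCF (phase a) f) = translate a (𝓕 f) := by
  apply toTemperedDistribution_injective
  rw [← Lp.fourier_toTemperedDistribution_eq]
  ext g
  have key : ∀ x, 𝓕 g x * phase a x = 𝓕 (g.compSubConstCLM ℂ a) x := by
    intro x
    have h := congrFun (VectorFourier.fourierIntegral_comp_add_right 𝐞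
      (volume : Measure (Space d)) (innerₗ (Space d)) g (-a)) x
    have h' : 𝓕 (g.compSubConstCLM ℂ a) x = VectorFourier.fourierIntegral 𝐞 volume
        (innerₗ (Space d)) (g ∘ fun v ↦ v + -a) x := by
      rw [SchwartzMap.fourier_coe]
      simp only [← sub_eq_add_neg]
      rfl
    rw [h', h, innerₗ_apply_apply, inner_neg_left, real_inner_comm, fourierChar_smul_eq,
      SchwartzMap.fourier_coe, mul_comm]
    rfl
  calc
    _ = ∫ x, 𝓕 g x • mulBCF (phase a) f x := by
      rw [TemperedDistribution.fourier_apply, Lp.toTemperedDistribution_apply]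
    _ = ∫ x, 𝓕 (g.compSubConstCLM ℂ a) x • f x := by
      apply integral_congr_ae
      filter_upwards [coeFn_mulBCF (phase a) f] with x hx
      rw [hx, ← key, smul_eq_mul, smul_eq_mul, mul_assoc]
    _ = ∫ x, g.compSubConstCLM ℂ a x • (𝓕 f : L2 d) x := by
      rw [← Lp.toTemperedDistribution_apply, ← Lp.toTemperedDistribution_apply,
        ← Lp.fourier_toTemperedDistribution_eq, TemperedDistribution.fourier_apply]
    _ = ∫ x, g x • (𝓕 f : L2 d) (x + a) := by
      rw [← integral_add_right_eq_self _ a]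
      simp
    _ = _ := by
      rw [Lp.toTemperedDistribution_apply]
      apply integral_congr_ae
      filter_upwards [coeFn_translate a (𝓕 f)] with x hx
      rw [hx]

/-! ### Limits and derivatives in `L²` norm -/

/-- Dominated convergence in `L²`. -/
theorem tendsto_L2_of_dominated {ι : Type*} {l : Filter ι} [l.IsCountablyGenerated]
    {F : ι → L2 d} {f : L2 d} {G : ι → Space d → ℂ} {B : Space d → ℝ} (hB : MemLp B 2 volume)
    (hFG : ∀ᶠ i in l, ∀ᵐ x, F i x = G i x) (hFB : ∀ᶠ i in l, ∀ᵐ x, ‖G i x - f x‖ ≤ B x)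
    (hlim : ∀ᵐ x, Tendsto (fun i ↦ G i x) l (𝓝 (f x))) : Tendsto F l (𝓝 f) := by
  rw [Lp.tendsto_Lp_iff_tendsto_eLpNorm']
  have h : ∀ᶠ i in l, (∫⁻ x, ‖G i x - f x‖ₑ ^ (2 : ℝ)) ^ (1 / 2 : ℝ) =
      eLpNorm (⇑(F i) - ⇑f) 2 volume := by
    filter_upwards [hFG] with i hi
    rw [eLpNorm_eq_lintegral_rpow_enorm_toReal (by norm_num) (by norm_num), ENNReal.toReal_ofNat]
    congr 1
    apply lintegral_congr_ae
    filter_upwards [hi] with x hx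
    rw [Pi.sub_apply, hx]
  refine Tendsto.congr' h ?_
  have h0 : (0 : ℝ≥0∞) = (∫⁻ _ : Space d, 0) ^ (1 / 2 : ℝ) := by simp
  rw [h0]
  refine ((ENNReal.continuous_rpow_const (y := 1 / 2)).tendsto _).comp ?_
  refine tendsto_lintegral_filter_of_dominated_convergence' (fun x ↦ ‖B x‖ₑ ^ (2 : ℝ)) ?_ ?_ ?_ ?_
  · filter_upwards [hFG] with i hi
    have : AEStronglyMeasurable (G i) volume := (Lp.aestronglyMeasurable (F i)).congr hi
    exact ((this.sub (Lp.aestronglyMeasurable _)).enorm).pow_const _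
  · filter_upwards [hFB] with i hi
    filter_upwards [hi] with x hx
    gcongr
    rw [enorm_le_iff_norm_le]
    exact hx.trans (le_abs_self _)
  · have := lintegral_rpow_enorm_lt_top_of_eLpNorm_lt_top (by norm_num) (by norm_num) hB.2
    simpa using this.ne
  · filter_upwards [hlim] with x hx
    have : Tendsto (fun i ↦ ‖G i x - f x‖ₑ) l (𝓝 0) := by
      have := (hx.sub_const (f x)).enorm
      simpa using this
    have h2 := ((ENNReal.continuous_rpow_const (y := 2)).tendsto 0).comp this
    simpa [Function.comp_def] using h2

/-- Differentiation under the `L²` norm of a curve of multiples of a fixed function. -/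
theorem hasDerivAt_L2_of_dominated {φ φ' : ℝ → Space d → ℂ} {u : L2 d} {g : ℝ → L2 d} {g' : L2 d}
    {t₀ ε : ℝ} (hε : 0 < ε) (hg : ∀ t ∈ Metric.ball t₀ ε, ∀ᵐ x, g t x = φ t x * u x)
    (hg' : ∀ᵐ x, g' x = φ' t₀ x * u x) {B : Space d → ℝ}
    (hφ : ∀ t ∈ Metric.ball t₀ ε, ∀ x, HasDerivAt (fun s ↦ φ s x) (φ' t x) t)
    (hφB : ∀ t ∈ Metric.ball t₀ ε, ∀ x, ‖φ' t x‖ ≤ B x)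
    (hB : MemLp (fun x ↦ B x * ‖u x‖) 2 volume) : HasDerivAt g g' t₀ := by
  rw [hasDerivAt_iff_tendsto_slope]
  have ht₀ : t₀ ∈ Metric.ball t₀ ε := Metric.mem_ball_self hε
  have hball : ∀ᶠ t in 𝓝[≠] t₀, t ∈ Metric.ball t₀ ε :=
    eventually_nhdsWithin_of_eventually_nhds (Metric.ball_mem_nhds _ hε)
  -- The mean value inequality bounds the difference quotient by `B`, and the derivative is also at
  -- most `B`; hence the factor 2.
  refine tendsto_L2_of_dominated (G := fun t x ↦ slope (fun s ↦ φ s x) t₀ t * u x)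
    (hB.const_mul 2) ?_ ?_ ?_
  · filter_upwards [hball] with t ht
    filter_upwards [hg t ht, hg t₀ ht₀, Lp.coeFn_smul (t - t₀)⁻¹ (g t - g t₀),
      Lp.coeFn_sub (g t) (g t₀)] with x h₁ h₂ h₃ h₄
    rw [slope, vsub_eq_sub, h₃, Pi.smul_apply, h₄, Pi.sub_apply, h₁, h₂, slope, vsub_eq_sub,
      ← sub_mul, smul_mul_assoc]
  · filter_upwards [hball] with t ht
    filter_upwards [hg'] with x hx
    have h₁ : ‖slope (fun s ↦ φ s x) t₀ t‖ ≤ B x := by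
      have := (convex_ball t₀ ε).norm_image_sub_le_of_norm_hasDerivWithin_le
        (fun s hs ↦ (hφ s hs x).hasDerivWithinAt) (fun s hs ↦ hφB s hs x) ht₀ ht
      rw [slope, vsub_eq_sub, norm_smul, norm_inv]
      rcases eq_or_ne t t₀ with rfl | hne
      · simpa using (norm_nonneg _).trans (hφB t ht x)
      · rwa [inv_mul_le_iff₀ (norm_pos_iff.2 (sub_ne_zero.2 hne)), mul_comm]
    rw [hx, ← sub_mul, norm_mul, ← mul_assoc]
    gcongr
    refine (norm_sub_le _ _).trans ?_
    linarith [hφB t₀ ht₀ x]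
  · filter_upwards [hg'] with x hx
    rw [hx]
    exact (hasDerivAt_iff_tendsto_slope.1 (hφ t₀ ht₀ x)).mul_const _

/-! ### The action and the damping factor -/

/-- The integral of `‖ξ + s b‖²` over `0 ≤ s ≤ t`. -/
def action (b : Space d) (t : ℝ) (ξ : Space d) : ℝ :=
  t * ‖ξ‖ ^ 2 + t ^ 2 * inner ℝ ξ b + t ^ 3 * ‖b‖ ^ 2 / 3

/-- After Cauchy–Schwarz, the difference is exactly the square in `h₃`. This bound supplies the
decay in `ξ`. -/
theorem mul_sq_le_action (b ξ : Space d) {t : ℝ} (ht : 0 ≤ t) :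
    t * (‖ξ‖ ^ 2 / 4) ≤ action b t ξ := by
  have h₁ : -(‖ξ‖ * ‖b‖) ≤ inner ℝ ξ b := neg_le_of_abs_le (abs_real_inner_le_norm ξ b)
  have h₂ : t ^ 2 * -(‖ξ‖ * ‖b‖) ≤ t ^ 2 * inner ℝ ξ b := by gcongr
  have h₃ : 0 ≤ t * (3 * (‖ξ‖ / 2 - t * ‖b‖ / 3) ^ 2) := by positivity
  rw [action]
  linarith

/-- Again a completed square after Cauchy–Schwarz. The bound is uniform in `ξ` and attained at `ξ =
-t b / 2`; it is the source of the `exp(-c t³)` decay. -/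
theorem mul_cube_le_action (b ξ : Space d) {t : ℝ} (ht : 0 ≤ t) :
    t ^ 3 * ‖b‖ ^ 2 / 12 ≤ action b t ξ := by
  have h₁ : -(‖ξ‖ * ‖b‖) ≤ inner ℝ ξ b := neg_le_of_abs_le (abs_real_inner_le_norm ξ b)
  have h₂ : t ^ 2 * -(‖ξ‖ * ‖b‖) ≤ t ^ 2 * inner ℝ ξ b := by gcongr
  have h₃ : 0 ≤ t * (‖ξ‖ - t * ‖b‖ / 2) ^ 2 := by positivity
  rw [action]
  linarith

theorem action_nonneg (b ξ : Space d) {t : ℝ} (ht : 0 ≤ t) : 0 ≤ action b t ξ :=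
  le_trans (by positivity) (mul_sq_le_action b ξ ht)

theorem norm_add_smul_sq (b ξ : Space d) (t : ℝ) :
    ‖ξ + t • b‖ ^ 2 = ‖ξ‖ ^ 2 + 2 * t * inner ℝ ξ b + t ^ 2 * ‖b‖ ^ 2 := by
  rw [norm_add_sq_real, inner_smul_right, norm_smul, mul_pow, Real.norm_eq_abs, sq_abs]
  ring

theorem hasDerivAt_action (b ξ : Space d) (t : ℝ) :
    HasDerivAt (fun s ↦ action b s ξ) (‖ξ + t • b‖ ^ 2) t := by
  have h := (((hasDerivAt_id t).mul_const (‖ξ‖ ^ 2)).add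
    ((hasDerivAt_pow 2 t).mul_const (inner ℝ ξ b))).add
    (((hasDerivAt_pow 3 t).mul_const (‖b‖ ^ 2)).div_const 3)
  refine h.congr_deriv ?_
  rw [norm_add_smul_sq]
  push_cast
  ring

/-- Reversing time along the segment: `ξ - t b + s b = ξ - (t - s) b`. -/
theorem action_sub_smul (b ξ : Space d) (t : ℝ) : action b t (ξ - t • b) = action (-b) t ξ := by
  have h : ‖ξ - t • b‖ ^ 2 = ‖ξ‖ ^ 2 - 2 * t * inner ℝ ξ b + t ^ 2 * ‖b‖ ^ 2 := by
    have := norm_add_smul_sq b ξ (-t)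
    rw [neg_smul, ← sub_eq_add_neg] at this
    rw [this]; ring
  rw [action, action, h, inner_sub_left, real_inner_smul_left, inner_neg_right, norm_neg,
    real_inner_self_eq_norm_sq]
  ring

theorem continuous_action (b : Space d) : Continuous fun p : ℝ × Space d ↦ action b p.1 p.2 := by
  unfold action
  fun_prop

/-- The damping factor `exp (-4π² ∫₀ᵗ ‖ξ + s b‖² ds)`. -/
def damp (b : Space d) (t : ℝ) (ξ : Space d) : ℝ := Real.exp (-(4 * π ^ 2 * action b t ξ))

theorem damp_le_exp_cube (b ξ : Space d) {t : ℝ} (ht : 0 ≤ t) :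
    damp b t ξ ≤ Real.exp (-(π ^ 2 * ‖b‖ ^ 2 / 3 * t ^ 3)) := by
  rw [damp, Real.exp_le_exp, neg_le_neg_iff]
  have := mul_le_mul_of_nonneg_left (mul_cube_le_action b ξ ht) (show 0 ≤ 4 * π ^ 2 by positivity)
  linarith

theorem damp_pos (b ξ : Space d) (t : ℝ) : 0 < damp b t ξ := Real.exp_pos _

theorem damp_le_one (b ξ : Space d) {t : ℝ} (ht : 0 ≤ t) : damp b t ξ ≤ 1 :=
  Real.exp_le_one_iff.2 (neg_nonpos.2 (mul_nonneg (by positivity) (action_nonneg b ξ ht)))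

theorem continuous_damp (b : Space d) : Continuous fun p : ℝ × Space d ↦ damp b p.1 p.2 := by
  have := continuous_action b
  unfold damp
  fun_prop

theorem hasDerivAt_damp (b ξ : Space d) (t : ℝ) :
    HasDerivAt (fun s ↦ damp b s ξ) (-(4 * π ^ 2 * ‖ξ + t • b‖ ^ 2) * damp b t ξ) t := by
  have := ((hasDerivAt_action b ξ t).const_mul (4 * π ^ 2)).neg.exp
  refine this.congr_deriv ?_
  rw [damp, mul_comm]
  rfl

theorem damp_sub_smul (b ξ : Space d) (t : ℝ) : damp b t (ξ - t • b) = damp (-b) t ξ := by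
  rw [damp, damp, action_sub_smul]

/-- The damping factor at time `max t 0`, as a bounded continuous function. -/
def dampBCF (b : Space d) (t : ℝ) : Space d →ᵇ ℂ :=
  BoundedContinuousFunction.ofNormedAddCommGroup (fun ξ ↦ (damp b (max t 0) ξ : ℂ))
    (Complex.continuous_ofReal.comp ((continuous_damp b).comp (Continuous.prodMk_right (max t 0)))) 1
    (fun ξ ↦ by
      rw [Complex.norm_real, Real.norm_of_nonneg (damp_pos _ _ _).le]
      exact damp_le_one b ξ (le_max_right _ _))

theorem dampBCF_apply (b ξ : Space d) (t : ℝ) : dampBCF b t ξ = (damp b (max t 0) ξ : ℂ) := rfl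

theorem norm_dampBCF_le (b ξ : Space d) (t : ℝ) : ‖dampBCF b t ξ‖ ≤ 1 := by
  rw [dampBCF_apply, Complex.norm_real, Real.norm_of_nonneg (damp_pos _ _ _).le]
  exact damp_le_one b ξ (le_max_right _ _)

/-! ### The semigroup and its superexponential decay -/

/-- The semigroup generated by `-4π²‖ξ‖² + b · ∇`. -/
def evol (b : Space d) (t : ℝ) : L2 d →L[ℂ] L2 d := mulBCF (dampBCF b t) ∘L translate (t • b)

theorem evol_apply (b : Space d) (t : ℝ) (f : L2 d) :
    evol b t f = mulBCF (dampBCF b t) (translate (t • b) f) := rfl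

theorem coeFn_evol (b : Space d) {t : ℝ} (ht : 0 ≤ t) (f : L2 d) :
    evol b t f =ᵐ[volume] fun ξ ↦ (damp b t ξ : ℂ) * f (ξ + t • b) := by
  filter_upwards [coeFn_mulBCF (dampBCF b t) (translate (t • b) f), coeFn_translate (t • b) f]
    with ξ h₁ h₂
  rw [evol_apply, h₁, h₂, dampBCF_apply, max_eq_left ht]

theorem evol_zero (b : Space d) (f : L2 d) : evol b 0 f = f := by
  apply Lp.ext
  filter_upwards [coeFn_evol b le_rfl f] with ξ h
  rw [h]
  simp [damp, action]

theorem norm_evol_le (b : Space d) {t : ℝ} (ht : 0 ≤ t) (f : L2 d) :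
    ‖evol b t f‖ ≤ Real.exp (-(π ^ 2 * ‖b‖ ^ 2 / 3 * t ^ 3)) * ‖f‖ := by
  rw [evol_apply, ← norm_translate (t • b) f]
  refine norm_mulBCF_le (fun ξ ↦ ?_) _
  rw [dampBCF_apply, Complex.norm_real, Real.norm_of_nonneg (damp_pos _ _ _).le, max_eq_left ht]
  exact damp_le_exp_cube b ξ ht

theorem continuous_dampBCF_apply (b : Space d) (f : L2 d) :
    Continuous fun t ↦ mulBCF (dampBCF b t) f := by
  rw [continuous_iff_continuousAt]
  intro t₀
  refine tendsto_L2_of_dominated (G := fun t ξ ↦ dampBCF b t ξ * f ξ)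
    ((Lp.memLp f).norm.const_mul 2) (Eventually.of_forall fun t ↦ coeFn_mulBCF _ f)
    (Eventually.of_forall fun t ↦ ?_) ?_
  · filter_upwards [coeFn_mulBCF (dampBCF b t₀) f] with ξ h
    rw [h, ← sub_mul, norm_mul]
    gcongr
    refine (norm_sub_le _ _).trans ?_
    linarith [norm_dampBCF_le b ξ t, norm_dampBCF_le b ξ t₀]
  · filter_upwards [coeFn_mulBCF (dampBCF b t₀) f] with ξ h
    rw [h]
    refine Tendsto.mul_const _ (Continuous.tendsto ?_ t₀)
    simp only [dampBCF_apply]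
    exact Complex.continuous_ofReal.comp
      ((continuous_damp b).comp (by fun_prop : Continuous fun t : ℝ ↦ (max t 0, ξ)))

theorem continuous_evol (b : Space d) (f : L2 d) : Continuous fun t ↦ evol b t f := by
  rw [continuous_iff_continuousAt]
  intro t₀
  have h₁ : Tendsto (fun t ↦ mulBCF (dampBCF b t) (translate (t₀ • b) f)) (𝓝 t₀)
      (𝓝 (evol b t₀ f)) := (continuous_dampBCF_apply b _).tendsto t₀
  have h₂ : Tendsto (fun t ↦ mulBCF (dampBCF b t) (translate (t • b) f - translate (t₀ • b) f))
      (𝓝 t₀) (𝓝 0) := by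
    have hc : Continuous fun t : ℝ ↦ translate (t • b) f :=
      (continuous_translate f).comp (by fun_prop)
    refine squeeze_zero_norm (fun t ↦ norm_mulBCF_le (norm_dampBCF_le b · t) _) ?_
    simpa using ((hc.tendsto t₀).sub_const (translate (t₀ • b) f)).norm.const_mul 1
  have := h₂.add h₁
  simp only [map_sub, sub_add_cancel, zero_add] at this
  exact this

/-- The damping is real and the translation is unitary; moving the translation past the damping
reverses the characteristics, so `b` becomes `-b`. -/
theorem inner_evol_left (b : Space d) {t : ℝ} (ht : 0 ≤ t) (f g : L2 d) :
    inner ℂ (evol b t f) g = inner ℂ f (evol (-b) t g) := by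
  rw [evol_apply, inner_mulBCF_left (fun ξ ↦ by rw [dampBCF_apply, Complex.conj_ofReal]),
    inner_translate_left]
  congr 1
  apply Lp.ext
  filter_upwards [coeFn_translate (-(t • b)) (mulBCF (dampBCF b t) g),
    ae_comp_add_right (coeFn_mulBCF (dampBCF b t) g) (-(t • b)), coeFn_evol (-b) ht g]
    with ξ h₁ h₂ h₃
  rw [h₁, h₂, h₃, dampBCF_apply, max_eq_left ht, ← sub_eq_add_neg, damp_sub_smul, smul_neg,
    ← sub_eq_add_neg]

/-- The cubic term absorbs the linear one once `t ≥ √(M / k)`; before that the linear term is at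
most `M √(M / k)`. -/
theorem exists_exp_neg_cube_le {k : ℝ} (hk : 0 < k) (m : ℝ) :
    ∃ C, ∀ t, 0 ≤ t → m * t - k * t ^ 3 ≤ C - t := by
  set M := |m| + 1
  have hM : 0 < M := by positivity
  refine ⟨M * √(M / k), fun t ht ↦ ?_⟩
  have h₁ : (m + 1) * t ≤ M * t :=
    mul_le_mul_of_nonneg_right (by linarith [le_abs_self m]) ht
  suffices M * t - k * t ^ 3 ≤ M * √(M / k) by linarith
  rcases le_total t (√(M / k)) with h | h
  · have h₂ : M * t ≤ M * √(M / k) := by gcongr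
    have : 0 ≤ k * t ^ 3 := by positivity
    linarith
  · have h₂ : M / k ≤ t ^ 2 := by
      rw [← Real.sq_sqrt (show 0 ≤ M / k by positivity)]
      gcongr
    have h₃ : M ≤ k * t ^ 2 := by rwa [div_le_iff₀' hk] at h₂
    have h₄ : M * t ≤ k * t ^ 2 * t := by gcongr
    have : 0 ≤ M * √(M / k) := by positivity
    nlinarith

theorem exists_norm_exp_smul_evol_le {b : Space d} (hb : b ≠ 0) (z : ℂ) :
    ∃ C, 0 ≤ C ∧ ∀ t : ℝ, 0 ≤ t → ∀ f : L2 d,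
      ‖Complex.exp (-(z * t)) • evol b t f‖ ≤ C * ‖f‖ * Real.exp (-t) := by
  have hb' : 0 < ‖b‖ := norm_pos_iff.2 hb
  obtain ⟨C, hC⟩ := exists_exp_neg_cube_le (show 0 < π ^ 2 * ‖b‖ ^ 2 / 3 by positivity) (-z.re)
  refine ⟨Real.exp C, (Real.exp_pos C).le, fun t ht f ↦ ?_⟩
  have h₁ : ‖Complex.exp (-(z * t))‖ = Real.exp (-z.re * t) := by
    rw [Complex.norm_exp]
    simp
  rw [norm_smul, h₁]
  calc _ ≤ Real.exp (-z.re * t) * (Real.exp (-(π ^ 2 * ‖b‖ ^ 2 / 3 * t ^ 3)) * ‖f‖) := by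
        gcongr
        exact norm_evol_le b ht f
    _ = Real.exp (-z.re * t - π ^ 2 * ‖b‖ ^ 2 / 3 * t ^ 3) * ‖f‖ := by
        rw [← mul_assoc, ← Real.exp_add, ← sub_eq_add_neg]
    _ ≤ Real.exp (C - t) * ‖f‖ :=
        mul_le_mul_of_nonneg_right (Real.exp_le_exp.2 (hC t ht)) (norm_nonneg _)
    _ = _ := by
        rw [sub_eq_add_neg, Real.exp_add]
        ring

theorem continuous_exp_smul_evol (b : Space d) (z : ℂ) (f : L2 d) :
    Continuous fun t : ℝ ↦ Complex.exp (-(z * t)) • evol b t f := by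
  have := continuous_evol b f
  fun_prop

theorem integrableOn_exp_smul_evol {b : Space d} (hb : b ≠ 0) (z : ℂ) (f : L2 d) :
    IntegrableOn (fun t : ℝ ↦ Complex.exp (-(z * t)) • evol b t f) (Ioi 0) := by
  obtain ⟨C, -, hC⟩ := exists_norm_exp_smul_evol_le hb z
  refine Integrable.mono' ((integrableOn_exp_neg_Ioi 0).const_mul (C * ‖f‖))
    (continuous_exp_smul_evol b z f).aestronglyMeasurable ?_
  filter_upwards [ae_restrict_mem measurableSet_Ioi] with t ht
  exact hC t (le_of_lt ht) f

/-! ### The Laplace transform and its adjoint -/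

/-- The Laplace transform of the semigroup. -/
def laplaceEvol {b : Space d} (hb : b ≠ 0) (z : ℂ) : L2 d →L[ℂ] L2 d :=
  LinearMap.mkContinuousOfExistsBound
    { toFun := fun f ↦ ∫ t in Ioi (0 : ℝ), Complex.exp (-(z * t)) • evol b t f
      map_add' := fun f g ↦ by
        simp only [map_add, smul_add]
        exact integral_add (integrableOn_exp_smul_evol hb z f) (integrableOn_exp_smul_evol hb z g)
      map_smul' := fun c f ↦ by
        simp only [map_smul, RingHom.id_apply, ← integral_smul, smul_comm c] } <| by
    obtain ⟨C, -, hC⟩ := exists_norm_exp_smul_evol_le hb z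
    refine ⟨C, fun f ↦ ?_⟩
    refine (norm_integral_le_of_norm_le ((integrableOn_exp_neg_Ioi 0).const_mul (C * ‖f‖))
      ?_).trans_eq ?_
    · filter_upwards [ae_restrict_mem measurableSet_Ioi] with t ht
      exact hC t (le_of_lt ht) f
    · rw [integral_const_mul, integral_exp_neg_Ioi_zero, mul_one]

theorem laplaceEvol_apply {b : Space d} (hb : b ≠ 0) (z : ℂ) (f : L2 d) :
    laplaceEvol hb z f = ∫ t in Ioi (0 : ℝ), Complex.exp (-(z * t)) • evol b t f := rfl

theorem inner_laplaceEvol_right {b : Space d} (hb : b ≠ 0) (z : ℂ) (v f : L2 d) :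
    inner ℂ v (laplaceEvol hb z f) =
      ∫ t in Ioi (0 : ℝ), Complex.exp (-(z * t)) * inner ℂ v (evol b t f) := by
  rw [laplaceEvol_apply, ← integral_inner (integrableOn_exp_smul_evol hb z f)]
  simp only [inner_smul_right]

theorem inner_laplaceEvol_left {b : Space d} (hb : b ≠ 0) (z : ℂ) (f g : L2 d) :
    inner ℂ (laplaceEvol hb z f) g =
      inner ℂ f (laplaceEvol (neg_ne_zero.2 hb) (starRingEnd ℂ z) g) := by
  rw [← inner_conj_symm, inner_laplaceEvol_right, inner_laplaceEvol_right, ← integral_conj]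
  apply setIntegral_congr_fun measurableSet_Ioi
  intro t ht
  simp only
  rw [map_mul, inner_conj_symm, inner_evol_left b (le_of_lt ht), ← Complex.exp_conj, map_neg,
    map_mul, Complex.conj_ofReal]

/-! ### Differentiating the semigroup: the left inverse -/

theorem hasDerivAt_phase_smul (b x : Space d) (t : ℝ) :
    HasDerivAt (fun s : ℝ ↦ phase (s • b) x)
      (-(2 * π * inner ℝ x b : ℝ) * Complex.I * phase (t • b) x) t := by
  have h : ∀ s : ℝ, phase (s • b) x =
      Complex.exp (s * (-(2 * π * inner ℝ x b : ℝ) * Complex.I)) := by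
    intro s
    rw [phase_apply, inner_smul_right]
    congr 1
    push_cast
    ring
  simp_rw [h]
  have := ((Complex.ofRealCLM.hasDerivAt (x := t)).mul_const
    (-((2 * π * inner ℝ x b : ℝ) : ℂ) * Complex.I)).cexp
  refine this.congr_deriv ?_
  simp [mul_comm]

/-- Translates of `𝓕 u` are Fourier transforms of modulations of `u`. These are differentiable in
`L²` because `|2π⟨x, b⟩ u|` is a square integrable dominating function. -/
theorem hasDerivAt_translate_fourier (b : Space d) {u q : L2 d}
    (hq : ∀ᵐ x, q x = (2 * π * inner ℝ x b : ℝ) * Complex.I * u x) (t : ℝ) :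
    HasDerivAt (fun s : ℝ ↦ translate (s • b) (𝓕 u)) (-translate (t • b) (𝓕 q)) t := by
  have h : HasDerivAt (fun s : ℝ ↦ mulBCF (phase (s • b)) u) (-mulBCF (phase (t • b)) q) t := by
    refine hasDerivAt_L2_of_dominated (φ := fun s x ↦ phase (s • b) x)
      (φ' := fun s x ↦ -(2 * π * inner ℝ x b : ℝ) * Complex.I * phase (s • b) x) (u := u)
      (B := fun x ↦ |2 * π * inner ℝ x b|) one_pos (fun s _ ↦ coeFn_mulBCF _ u) ?_
      (fun s _ x ↦ hasDerivAt_phase_smul b x s) (fun s _ x ↦ ?_) ?_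
    · filter_upwards [Lp.coeFn_neg (mulBCF (phase (t • b)) q), coeFn_mulBCF (phase (t • b)) q, hq]
        with x h₁ h₂ h₃
      rw [h₁, Pi.neg_apply, h₂, h₃]
      ring
    · rw [norm_mul, norm_phase, norm_mul, norm_neg, Complex.norm_I, Complex.norm_real, mul_one,
        mul_one, Real.norm_eq_abs]
    · refine (Lp.memLp q).norm.ae_eq ?_
      filter_upwards [hq] with x hx
      rw [hx, norm_mul, norm_mul, Complex.norm_I, Complex.norm_real, mul_one, Real.norm_eq_abs]
  have := (((Lp.fourierTransformₗᵢ (Space d) ℂ).toContinuousLinearEquiv :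
    L2 d →L[ℂ] L2 d).restrictScalars ℝ).hasFDerivAt.comp_hasDerivAt t h
  have e : ∀ s : ℝ, translate (s • b) (𝓕 u) =
      (Lp.fourierTransformₗᵢ (Space d) ℂ) (mulBCF (phase (s • b)) u) :=
    fun s ↦ (fourier_mulBCF_phase _ _).symm
  simp_rw [e, ← fourier_mulBCF_phase]
  refine this.congr_deriv ?_
  simp
  rfl

theorem memLp_norm_sq_mul (v : 𝓢(Space d, ℂ)) (c₁ c₂ : ℝ) :
    MemLp (fun ξ ↦ (c₁ * ‖ξ‖ ^ 2 + c₂) * ‖v ξ‖) 2 volume := by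
  have h := (SchwartzMap.smulLeftCLM ℂ (fun ξ : Space d ↦ c₁ * ‖ξ‖ ^ 2 + c₂) v).memLp 2 volume
  have hg : (fun ξ : Space d ↦ c₁ * ‖ξ‖ ^ 2 + c₂).HasTemperateGrowth := by fun_prop
  refine h.norm.mono ?_ (Eventually.of_forall fun ξ ↦ ?_)
  · exact Continuous.aestronglyMeasurable (by fun_prop)
  · simp [hg, -Complex.ofReal_add, -Complex.ofReal_mul]

theorem exists_hasDerivAt_dampBCF (b : Space d) (v : 𝓢(Space d, ℂ)) {t : ℝ} (ht : 0 < t) :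
    ∃ w : L2 d, (∀ᵐ ξ, w ξ = -(4 * π ^ 2 * ‖ξ + t • b‖ ^ 2 : ℝ) * damp b t ξ * v ξ) ∧
      HasDerivAt (fun s ↦ mulBCF (dampBCF b s) (v.toLp 2)) w t := by
  -- Dominates the derivative for all `s` in `(0, 2t)`, using `s ≤ 2t` and `(x + y)² ≤ 2x² + 2y²`.
  set B : Space d → ℝ := fun ξ ↦ 8 * π ^ 2 * ‖ξ‖ ^ 2 + 8 * π ^ 2 * (2 * t * ‖b‖) ^ 2
  have hB : MemLp (fun ξ ↦ B ξ * ‖v ξ‖) 2 volume := memLp_norm_sq_mul v _ _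
  have hbd : ∀ s ∈ Metric.ball t t, ∀ ξ,
      ‖(-(4 * π ^ 2 * ‖ξ + s • b‖ ^ 2 : ℝ) * damp b s ξ : ℂ)‖ ≤ B ξ := by
    intro s hs ξ
    rw [Metric.mem_ball, Real.dist_eq, abs_lt] at hs
    have hs0 : 0 ≤ s := by linarith
    rw [norm_mul, norm_neg, Complex.norm_real, Complex.norm_real,
      Real.norm_of_nonneg (by positivity), Real.norm_of_nonneg (damp_pos _ _ _).le]
    have h₁ : ‖ξ + s • b‖ ≤ ‖ξ‖ + 2 * t * ‖b‖ := by
      refine (norm_add_le _ _).trans ?_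
      rw [norm_smul, Real.norm_of_nonneg hs0]
      gcongr
      linarith
    have h₂ : ‖ξ + s • b‖ ^ 2 ≤ 2 * ‖ξ‖ ^ 2 + 2 * (2 * t * ‖b‖) ^ 2 := by
      calc _ ≤ (‖ξ‖ + 2 * t * ‖b‖) ^ 2 := by gcongr
        _ ≤ _ := by linarith [sq_nonneg (‖ξ‖ - 2 * t * ‖b‖)]
    calc _ ≤ 4 * π ^ 2 * ‖ξ + s • b‖ ^ 2 * 1 := by
          gcongr
          exact damp_le_one b ξ hs0
      _ ≤ 4 * π ^ 2 * (2 * ‖ξ‖ ^ 2 + 2 * (2 * t * ‖b‖) ^ 2) := by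
          rw [mul_one]
          gcongr
      _ = B ξ := by simp only [B]; ring
  have hcd : Continuous (damp b t) := (continuous_damp b).comp (Continuous.prodMk_right t)
  have hw : MemLp (fun ξ ↦ -(4 * π ^ 2 * ‖ξ + t • b‖ ^ 2 : ℝ) * damp b t ξ * v ξ) 2 volume := by
    refine hB.mono' (Continuous.aestronglyMeasurable (by fun_prop))
      (Eventually.of_forall fun ξ ↦ ?_)
    rw [norm_mul]
    gcongr
    exact hbd t (Metric.mem_ball_self ht) ξ
  refine ⟨hw.toLp _, hw.coeFn_toLp, ?_⟩
  refine hasDerivAt_L2_of_dominated (φ := fun s ξ ↦ (damp b s ξ : ℂ))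
      (φ' := fun s ξ ↦ -(4 * π ^ 2 * ‖ξ + s • b‖ ^ 2 : ℝ) * damp b s ξ) (u := v.toLp 2)
      (B := B) ht (fun s hs ↦ ?_) ?_ (fun s _ ξ ↦ ?_) hbd ?_
  · rw [Metric.mem_ball, Real.dist_eq, abs_lt] at hs
    filter_upwards [coeFn_mulBCF (dampBCF b s) (v.toLp 2)] with ξ h
    rw [h, dampBCF_apply, max_eq_left (by linarith)]
  · filter_upwards [hw.coeFn_toLp, v.coeFn_toLp 2] with ξ h₁ h₂
    rw [h₁, h₂]
  · have := (hasDerivAt_damp b ξ s).ofReal_comp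
    exact this.congr_deriv (by push_cast; ring)
  · refine hB.ae_eq ?_
    filter_upwards [v.coeFn_toLp 2] with ξ h
    rw [h]

/-- The self-adjoint damping is moved onto the Schwartz function, so that each side of the inner
product is differentiable in norm. Differentiating the damping produces `‖ξ + t b‖²`, which is the
weight of `p` after translation. -/
theorem hasDerivAt_inner_evol (b : Space d) (v : 𝓢(Space d, ℂ)) {u p q : L2 d}
    (hp : ∀ᵐ ξ, p ξ = (4 * π ^ 2 * ‖ξ‖ ^ 2 : ℝ) * (𝓕 u : L2 d) ξ)
    (hq : ∀ᵐ x, q x = (2 * π * inner ℝ x b : ℝ) * Complex.I * u x) {t : ℝ} (ht : 0 < t) :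
    HasDerivAt (fun s ↦ inner ℂ (v.toLp 2 : L2 d) (evol b s (𝓕 u)))
      (-inner ℂ (v.toLp 2 : L2 d) (evol b t (p + 𝓕 q))) t := by
  obtain ⟨w, hw, hwd⟩ := exists_hasDerivAt_dampBCF b v ht
  have hsa : ∀ s (f g : L2 d), inner ℂ f (mulBCF (dampBCF b s) g) =
      inner ℂ (mulBCF (dampBCF b s) f) g := fun s f g ↦
    (inner_mulBCF_left (fun ξ ↦ by rw [dampBCF_apply, Complex.conj_ofReal]) f g).symm
  simp_rw [evol_apply, hsa]
  refine (hwd.inner ℂ (hasDerivAt_translate_fourier b hq t)).congr_deriv ?_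
  rw [map_add, inner_add_right, inner_neg_right, neg_add, add_comm]
  congr 1
  rw [inner_L2_eq, inner_L2_eq, ← integral_neg]
  apply integral_congr_ae
  filter_upwards [hw, coeFn_translate (t • b) (𝓕 u), coeFn_translate (t • b) p,
    ae_comp_add_right hp (t • b), coeFn_mulBCF (dampBCF b t) (v.toLp 2), v.coeFn_toLp 2]
    with ξ h₁ h₂ h₃ h₄ h₅ h₆
  rw [h₁, h₂, h₃, h₄, h₅, h₆, dampBCF_apply, max_eq_left ht.le]
  simp only [map_mul, map_neg, Complex.conj_ofReal]
  ring

theorem eq_of_inner_schwartz_eq {f g : L2 d}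
    (h : ∀ v : 𝓢(Space d, ℂ), inner ℂ (v.toLp 2 : L2 d) f = inner ℂ (v.toLp 2 : L2 d) g) :
    f = g := by
  have hd : DenseRange (SchwartzMap.toLpCLM ℝ ℂ 2 (volume : Measure (Space d))) :=
    SchwartzMap.denseRange_toLpCLM (by norm_num)
  refine ext_inner_left ℂ fun w ↦ ?_
  refine hd.induction_on w (isClosed_eq (by fun_prop) (by fun_prop)) h

/-- The Laplace transform of the semigroup is a left inverse of `4π²‖ξ‖² - b · ∇ + z`. -/
theorem laplaceEvol_generator {b : Space d} (hb : b ≠ 0) (z : ℂ) {u p q : L2 d}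
    (hp : ∀ᵐ ξ, p ξ = (4 * π ^ 2 * ‖ξ‖ ^ 2 : ℝ) * (𝓕 u : L2 d) ξ)
    (hq : ∀ᵐ x, q x = (2 * π * inner ℝ x b : ℝ) * Complex.I * u x) :
    laplaceEvol hb z (p + 𝓕 q + z • 𝓕 u) = 𝓕 u := by
  refine eq_of_inner_schwartz_eq fun v ↦ ?_
  set f : L2 d := p + 𝓕 q + z • 𝓕 u with hf
  set v' : L2 d := v.toLp 2
  have hexp : ∀ t : ℝ, HasDerivAt (fun s : ℝ ↦ Complex.exp (-(z * s)))
      (-z * Complex.exp (-(z * t))) t := by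
    intro t
    have := ((Complex.ofRealCLM.hasDerivAt (x := t)).const_mul z).neg.cexp
    exact this.congr_deriv (by simp [mul_comm])
  have hder : ∀ t ∈ Ioi (0 : ℝ), HasDerivAt
      (fun s : ℝ ↦ Complex.exp (-(z * s)) * inner ℂ v' (evol b s (𝓕 u)))
      (-(Complex.exp (-(z * t)) * inner ℂ v' (evol b t f))) t := by
    intro t ht
    refine ((hexp t).mul (hasDerivAt_inner_evol b v hp hq ht)).congr_deriv ?_
    rw [hf, map_add _ (p + 𝓕 q), inner_add_right, map_smul, inner_smul_right]
    ring
  have hint : IntegrableOn (fun t : ℝ ↦ Complex.exp (-(z * t)) * inner ℂ v' (evol b t f))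
      (Ioi 0) := by
    have := (integrableOn_exp_smul_evol hb z f).const_inner (𝕜 := ℂ) v'
    simp only [inner_smul_right] at this
    exact this
  have hcont : Continuous
      fun s : ℝ ↦ Complex.exp (-(z * s)) * inner ℂ v' (evol b s (𝓕 u)) := by
    have := continuous_evol b (𝓕 u)
    fun_prop
  have hlim : Tendsto (fun s : ℝ ↦ Complex.exp (-(z * s)) * inner ℂ v' (evol b s (𝓕 u)))
      atTop (𝓝 0) := by
    obtain ⟨C, hC0, hC⟩ := exists_norm_exp_smul_evol_le hb z
    refine squeeze_zero_norm' (a := fun t ↦ ‖v'‖ * (C * ‖(𝓕 u : L2 d)‖ * Real.exp (-t))) ?_ ?_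
    · filter_upwards [eventually_ge_atTop 0] with t ht
      rw [← inner_smul_right]
      exact (norm_inner_le_norm _ _).trans (by gcongr; exact hC t ht _)
    · have := (Real.tendsto_exp_neg_atTop_nhds_zero.const_mul (C * ‖(𝓕 u : L2 d)‖)).const_mul ‖v'‖
      simpa using this
  -- The integrand of the Laplace transform of `f` is minus a derivative, so only the boundary value
  -- at `t = 0` survives.
  have := integral_Ioi_of_hasDerivAt_of_tendsto hcont.continuousWithinAt hder hint.neg hlim
  rw [integral_neg] at this
  rw [inner_laplaceEvol_right]
  simpa [evol_zero] using this

/-! ### Schur test: two derivatives of regularity -/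

theorem lintegral_deriv_mul_exp_neg_le_one {G G' : ℝ → ℝ} (hG : ∀ t, HasDerivAt G (G' t) t)
    (hG' : ∀ t, 0 ≤ G' t) (hG0 : G 0 = 0) (hlim : Tendsto G atTop atTop) :
    ∫⁻ t in Ioi (0 : ℝ), ENNReal.ofReal (G' t * Real.exp (-G t)) ≤ 1 := by
  have hd : ∀ t ∈ Ici (0 : ℝ), HasDerivAt (fun s ↦ -Real.exp (-G s)) (G' t * Real.exp (-G t)) t := by
    intro t _
    exact (hG t).neg.exp.neg.congr_deriv (by simp only [Pi.neg_apply]; ring)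
  have hl : Tendsto (fun s ↦ -Real.exp (-G s)) atTop (𝓝 0) := by
    have := (Real.tendsto_exp_neg_atTop_nhds_zero.comp hlim).neg
    simpa [Function.comp_def] using this
  have hpos : ∀ t, 0 ≤ G' t * Real.exp (-G t) := fun t ↦ mul_nonneg (hG' t) (Real.exp_pos _).le
  rw [← ofReal_integral_eq_lintegral_ofReal
    (integrableOn_Ioi_deriv_of_nonneg' hd (fun t _ ↦ hpos t) hl)
    (Eventually.of_forall hpos),
    integral_Ioi_of_hasDerivAt_of_nonneg' hd (fun t _ ↦ hpos t) hl]
  simp [hG0]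

theorem one_le_pi_sq : 1 ≤ π ^ 2 := one_le_pow₀ (by linarith [Real.pi_gt_three])

/-- First Schur marginal, at fixed `ξ`. The bound `t‖ξ‖²/4` on the action gives an integrable
exponential of rate `π²‖ξ‖²`. -/
theorem lintegral_norm_sq_mul_damp_le_one (b ξ : Space d) :
    ∫⁻ t in Ioi (0 : ℝ), ENNReal.ofReal (‖ξ‖ ^ 2 * damp b t ξ) ≤ 1 := by
  rcases eq_or_ne ξ 0 with rfl | hξ
  · simp
  have hξ' : 0 < ‖ξ‖ := norm_pos_iff.2 hξ
  refine le_trans ?_ (lintegral_deriv_mul_exp_neg_le_one (G := fun t ↦ π ^ 2 * ‖ξ‖ ^ 2 * t)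
    (G' := fun _ ↦ π ^ 2 * ‖ξ‖ ^ 2) (fun t ↦ by simpa using (hasDerivAt_id t).const_mul _)
    (fun t ↦ by positivity) (by simp) (tendsto_id.const_mul_atTop (by positivity)))
  refine setLIntegral_mono' measurableSet_Ioi fun t ht ↦ ENNReal.ofReal_le_ofReal ?_
  refine mul_le_mul ?_ ?_ (damp_pos _ _ _).le (by positivity)
  · exact le_mul_of_one_le_left (by positivity) one_le_pi_sq
  · rw [damp, Real.exp_le_exp, neg_le_neg_iff]
    have := mul_le_mul_of_nonneg_left (mul_sq_le_action b ξ (le_of_lt ht))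
      (show 0 ≤ 4 * π ^ 2 by positivity)
    linarith

/-- Second Schur marginal, at fixed endpoint `η = ξ + t b`. Here `‖η - t b‖²` is the derivative of
the reversed action, so the integrand is dominated by an exact derivative. -/
theorem lintegral_norm_sub_smul_sq_mul_damp_le_one {b : Space d} (hb : b ≠ 0) (η : Space d) :
    ∫⁻ t in Ioi (0 : ℝ), ENNReal.ofReal (‖η - t • b‖ ^ 2 * damp b t (η - t • b)) ≤ 1 := by
  have hb' : 0 < ‖b‖ := norm_pos_iff.2 hb
  have hlim : Tendsto (fun t ↦ 4 * π ^ 2 * action (-b) t η) atTop atTop := by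
    refine Tendsto.const_mul_atTop (by positivity) ?_
    refine tendsto_atTop_mono' atTop (f₁ := fun t ↦ ‖b‖ ^ 2 / 12 * t ^ 3) ?_
      ((tendsto_pow_atTop (by norm_num)).const_mul_atTop (by positivity))
    filter_upwards [eventually_ge_atTop 0] with t ht
    have := mul_cube_le_action (-b) η ht
    rw [norm_neg] at this
    linarith
  refine le_trans ?_ (lintegral_deriv_mul_exp_neg_le_one
    (G := fun t ↦ 4 * π ^ 2 * action (-b) t η) (G' := fun t ↦ 4 * π ^ 2 * ‖η + t • (-b)‖ ^ 2)
    (fun t ↦ (hasDerivAt_action (-b) η t).const_mul _) (fun t ↦ by positivity)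
    (by simp [action]) hlim)
  refine setLIntegral_mono' measurableSet_Ioi fun t ht ↦ ENNReal.ofReal_le_ofReal ?_
  rw [damp_sub_smul, damp, smul_neg, ← sub_eq_add_neg]
  gcongr
  refine le_mul_of_one_le_left (by positivity) ?_
  linarith [one_le_pi_sq]

theorem lintegral_enorm_sq (v : L2 d) : ∫⁻ ξ, ‖v ξ‖ₑ ^ 2 = ‖v‖ₑ ^ 2 := by
  rw [Lp.enorm_def, eLpNorm_eq_lintegral_rpow_enorm_toReal (by norm_num) (by norm_num),
    ENNReal.toReal_ofNat, ← ENNReal.rpow_natCast, ← ENNReal.rpow_mul]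
  simp

/-- The bounded multiplier `min (‖ξ‖², n)`. -/
def truncSq (d n : ℕ) : Space d →ᵇ ℂ :=
  BoundedContinuousFunction.ofNormedAddCommGroup (fun ξ ↦ ((min (‖ξ‖ ^ 2) n : ℝ) : ℂ))
    (by fun_prop) n (fun ξ ↦ by
      rw [Complex.norm_real, Real.norm_of_nonneg (by positivity)]
      exact min_le_right _ _)

theorem truncSq_apply (n : ℕ) (ξ : Space d) : truncSq d n ξ = ((min (‖ξ‖ ^ 2) n : ℝ) : ℂ) := rfl

/-- Pair the truncated function `v` with itself, expand one copy as the Laplace integral, and split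
the product `‖v ξ‖ ‖f (ξ + t b)‖` by `2xy ≤ x² + y²`. The two marginals bound the two pieces by
`‖v‖²` and `‖f‖²`. -/
theorem norm_truncSq_laplaceEvol_le {b : Space d} (hb : b ≠ 0) (n : ℕ) (f : L2 d) :
    ‖mulBCF (truncSq d n) (laplaceEvol hb 1 f)‖ₑ ≤ ‖f‖ₑ := by
  set u := laplaceEvol hb 1 f
  set v := mulBCF (truncSq d n) u
  have hvm : Measurable v := (Lp.stronglyMeasurable v).measurable
  have hfm : Measurable f := (Lp.stronglyMeasurable f).measurable
  have hdm : Measurable fun p : ℝ × Space d ↦ damp b p.1 p.2 := (continuous_damp b).measurable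
  let k : ℝ → Space d → ℝ≥0∞ := fun t ξ ↦ ENNReal.ofReal (‖ξ‖ ^ 2 * damp b t ξ)
  have hk : Measurable fun p : ℝ × Space d ↦ k p.1 p.2 := by fun_prop
  have h₁ : ‖v‖ₑ ^ 2 ≤ ∫⁻ t in Ioi (0 : ℝ), ∫⁻ ξ, k t ξ * (‖v ξ‖ₑ * ‖f (ξ + t • b)‖ₑ) := by
    have e : inner ℂ v v = inner ℂ (mulBCF (truncSq d n) v) u :=
      (inner_mulBCF_left (fun ξ ↦ by rw [truncSq_apply, Complex.conj_ofReal]) v u).symm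
    have e' : ‖v‖ₑ ^ 2 = ‖inner ℂ v v‖ₑ := by
      rw [inner_self_eq_norm_sq_to_K, enorm_pow]
      congr 1
      simp [enorm_eq_nnnorm]
    rw [e', e, inner_laplaceEvol_right]
    refine (enorm_integral_le_lintegral_enorm _).trans ?_
    refine setLIntegral_mono' measurableSet_Ioi fun t ht ↦ ?_
    have ht' : 0 ≤ t := le_of_lt ht
    rw [enorm_mul]
    have hexp : ‖Complex.exp (-(1 * t))‖ₑ ≤ 1 := by
      rw [← ofReal_norm, Complex.norm_exp, ENNReal.ofReal_le_one, Real.exp_le_one_iff]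
      simpa using ht'
    refine (mul_le_of_le_one_left' hexp).trans ?_
    rw [inner_L2_eq]
    refine (enorm_integral_le_lintegral_enorm _).trans (lintegral_mono_ae ?_)
    filter_upwards [coeFn_mulBCF (truncSq d n) v, coeFn_evol b ht' f] with ξ h₁ h₂
    rw [h₁, h₂, map_mul, truncSq_apply, Complex.conj_ofReal, enorm_mul, enorm_mul, enorm_mul,
      RCLike.enorm_conj]
    have e₁ : ‖((min (‖ξ‖ ^ 2) n : ℝ) : ℂ)‖ₑ ≤ ENNReal.ofReal (‖ξ‖ ^ 2) := by
      rw [← ofReal_norm, Complex.norm_real, Real.norm_of_nonneg (by positivity)]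
      exact ENNReal.ofReal_le_ofReal (min_le_left _ _)
    have e₂ : ‖(damp b t ξ : ℂ)‖ₑ = ENNReal.ofReal (damp b t ξ) := by
      rw [← ofReal_norm, Complex.norm_real, Real.norm_of_nonneg (damp_pos _ _ _).le]
    have e₃ : k t ξ = ENNReal.ofReal (‖ξ‖ ^ 2) * ENNReal.ofReal (damp b t ξ) :=
      ENNReal.ofReal_mul (by positivity)
    rw [e₂, e₃]
    calc _ ≤ ENNReal.ofReal (damp b t ξ) * ‖f (ξ + t • b)‖ₑ *
          (ENNReal.ofReal (‖ξ‖ ^ 2) * ‖v ξ‖ₑ) := by gcongr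
      _ = _ := by ring
  have h₂ : ∫⁻ t in Ioi (0 : ℝ), ∫⁻ ξ, k t ξ * ‖v ξ‖ₑ ^ 2 ≤ ‖v‖ₑ ^ 2 := by
    rw [lintegral_lintegral_swap (by fun_prop), ← lintegral_enorm_sq]
    refine lintegral_mono fun ξ ↦ ?_
    rw [lintegral_mul_const _ (by fun_prop)]
    exact mul_le_of_le_one_left' (lintegral_norm_sq_mul_damp_le_one b ξ)
  have h₃ : ∫⁻ t in Ioi (0 : ℝ), ∫⁻ ξ, k t ξ * ‖f (ξ + t • b)‖ₑ ^ 2 ≤ ‖f‖ₑ ^ 2 := by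
    have e : ∀ t : ℝ, ∫⁻ ξ, k t ξ * ‖f (ξ + t • b)‖ₑ ^ 2 =
        ∫⁻ η, k t (η - t • b) * ‖f η‖ₑ ^ 2 := by
      intro t
      rw [← lintegral_sub_right_eq_self _ (t • b)]
      simp
    simp_rw [e]
    rw [lintegral_lintegral_swap (by fun_prop), ← lintegral_enorm_sq]
    refine lintegral_mono fun η ↦ ?_
    rw [lintegral_mul_const _ (by fun_prop)]
    exact mul_le_of_le_one_left' (lintegral_norm_sub_smul_sq_mul_damp_le_one hb η)
  have h₄ : 2 * ‖v‖ₑ ^ 2 ≤ ‖v‖ₑ ^ 2 + ‖f‖ₑ ^ 2 := by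
    calc 2 * ‖v‖ₑ ^ 2
        ≤ 2 * ∫⁻ t in Ioi (0 : ℝ), ∫⁻ ξ, k t ξ * (‖v ξ‖ₑ * ‖f (ξ + t • b)‖ₑ) := by gcongr
      _ = ∫⁻ t in Ioi (0 : ℝ), ∫⁻ ξ, 2 * (k t ξ * (‖v ξ‖ₑ * ‖f (ξ + t • b)‖ₑ)) := by
          rw [← lintegral_const_mul _ (by fun_prop)]
          congr 1 with t
          rw [lintegral_const_mul _ (by fun_prop)]
      _ ≤ ∫⁻ t in Ioi (0 : ℝ), ∫⁻ ξ, (k t ξ * ‖v ξ‖ₑ ^ 2 + k t ξ * ‖f (ξ + t • b)‖ₑ ^ 2) := by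
          refine lintegral_mono fun t ↦ lintegral_mono fun ξ ↦ ?_
          have : 2 * ‖v ξ‖ₑ * ‖f (ξ + t • b)‖ₑ ≤ ‖v ξ‖ₑ ^ 2 + ‖f (ξ + t • b)‖ₑ ^ 2 := by
            simp only [enorm_eq_nnnorm]
            exact_mod_cast two_mul_le_add_sq ‖v ξ‖₊ ‖f (ξ + t • b)‖₊
          calc _ = k t ξ * (2 * ‖v ξ‖ₑ * ‖f (ξ + t • b)‖ₑ) := by ring
            _ ≤ k t ξ * (‖v ξ‖ₑ ^ 2 + ‖f (ξ + t • b)‖ₑ ^ 2) := by gcongr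
            _ = _ := by ring
      _ = (∫⁻ t in Ioi (0 : ℝ), ∫⁻ ξ, k t ξ * ‖v ξ‖ₑ ^ 2) +
          ∫⁻ t in Ioi (0 : ℝ), ∫⁻ ξ, k t ξ * ‖f (ξ + t • b)‖ₑ ^ 2 := by
          rw [← lintegral_add_left (by fun_prop)]
          congr 1 with t
          rw [lintegral_add_left (by fun_prop)]
      _ ≤ _ := by gcongr
  -- Cancelling `‖v‖²` requires it to be finite; this is why the multiplier is truncated.
  rw [two_mul, ENNReal.add_le_add_iff_left (by simp)] at h₄
  exact (ENNReal.pow_right_strictMono two_ne_zero).le_iff_le.1 h₄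

/-- Fatou's lemma as the truncation level tends to infinity, the bound being uniform in it. -/
theorem memLp_norm_sq_mul_laplaceEvol {b : Space d} (hb : b ≠ 0) (f : L2 d) :
    MemLp (fun ξ ↦ ((‖ξ‖ ^ 2 : ℝ) : ℂ) * laplaceEvol hb 1 f ξ) 2 volume := by
  set u := laplaceEvol hb 1 f
  have hu := Lp.aestronglyMeasurable u
  have hm : ∀ n : ℕ, AEStronglyMeasurable (fun ξ ↦ truncSq d n ξ * u ξ) volume :=
    fun n ↦ (truncSq d n).continuous.aestronglyMeasurable.mul hu
  refine ⟨(Continuous.aestronglyMeasurable (by fun_prop)).mul hu, ?_⟩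
  have h := Lp.eLpNorm_lim_le_liminf_eLpNorm (p := 2) hm
    (fun ξ ↦ ((‖ξ‖ ^ 2 : ℝ) : ℂ) * u ξ) (Eventually.of_forall fun ξ ↦ ?_)
  · refine (h.trans (liminf_le_of_frequently_le' (Frequently.of_forall fun n ↦ ?_))).trans_lt
      (enorm_lt_top (x := f))
    rw [← eLpNorm_congr_ae (coeFn_mulBCF (truncSq d n) u), ← Lp.enorm_def]
    exact norm_truncSq_laplaceEvol_le hb n f
  · refine Tendsto.mul_const _ (tendsto_const_nhds.congr' ?_)
    obtain ⟨m, hm⟩ := exists_nat_ge (‖ξ‖ ^ 2)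
    filter_upwards [eventually_ge_atTop m] with n hn
    rw [truncSq_apply, min_eq_left (hm.trans (by exact_mod_cast hn))]

/-! ### Right inverse and resolvent identities -/

/-- The Laplace transform of the semigroup is a right inverse of `4π²‖ξ‖² - b · ∇ + 1`. -/
theorem exists_generator_laplaceEvol {b : Space d} (hb : b ≠ 0) (f : L2 d) :
    ∃ u p q : L2 d, 𝓕 u = laplaceEvol hb 1 f ∧
      (∀ᵐ ξ, p ξ = (4 * π ^ 2 * ‖ξ‖ ^ 2 : ℝ) * (𝓕 u : L2 d) ξ) ∧
      (∀ᵐ x, q x = (2 * π * inner ℝ x b : ℝ) * Complex.I * u x) ∧ p + 𝓕 q + 𝓕 u = f := by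
  set w := laplaceEvol hb 1 f with hw
  set u : L2 d := 𝓕⁻ w with hu
  have hFu : 𝓕 u = w := fourier_fourierInv_eq w
  have hp' := (memLp_norm_sq_mul_laplaceEvol hb f).const_mul (4 * π ^ 2 : ℂ)
  set p : L2 d := hp'.toLp _ with hpdef
  have hp : ∀ᵐ ξ, p ξ = (4 * π ^ 2 * ‖ξ‖ ^ 2 : ℝ) * (𝓕 u : L2 d) ξ := by
    filter_upwards [hp'.coeFn_toLp] with ξ h
    rw [hpdef, h, hFu]
    push_cast
    ring
  -- The equation forces this `q`; it remains to identify it with `2πi⟨x, b⟩ u`, by testing against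
  -- smooth compactly supported functions.
  set q : L2 d := 𝓕⁻ (f - w - p) with hq
  have hFq : 𝓕 q = f - w - p := fourier_fourierInv_eq _
  refine ⟨u, p, q, hFu, hp, ?_, by rw [hFq, hFu]; abel⟩
  have huloc := (Lp.memLp u).locallyIntegrable (by norm_num)
  refine ae_eq_of_integral_contDiff_smul_eq ((Lp.memLp q).locallyIntegrable (by norm_num)) ?_ ?_
  · rw [← locallyIntegrableOn_univ] at huloc ⊢
    exact huloc.continuousOn_mul (Continuous.continuousOn (by fun_prop)) isOpen_univ.isLocallyClosed
  intro g hg hgc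
  have hg₁ : HasCompactSupport (Complex.ofRealCLM ∘ g) := hgc.comp_left rfl
  have hg₂ : ContDiff ℝ (⊤ : ℕ∞) (Complex.ofRealCLM ∘ g) := Complex.ofRealCLM.contDiff.comp hg
  set φ : 𝓢(Space d, ℂ) := hg₁.toSchwartzMap hg₂
  have hφ : ∀ x, φ x = (g x : ℂ) := fun x ↦ rfl
  have hg₃ : (fun ξ : Space d ↦ ((4 * π ^ 2 * ‖ξ‖ ^ 2 : ℝ) : ℂ)).HasTemperateGrowth := by fun_prop
  have hg₄ : (fun x : Space d ↦ ((2 * π * inner ℝ x (-b) : ℝ) : ℂ) * Complex.I).HasTemperateGrowth := by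
    fun_prop
  set pφ := SchwartzMap.smulLeftCLM ℂ (fun ξ : Space d ↦ ((4 * π ^ 2 * ‖ξ‖ ^ 2 : ℝ) : ℂ)) (𝓕 φ)
  set qφ := SchwartzMap.smulLeftCLM ℂ
    (fun x : Space d ↦ ((2 * π * inner ℝ x (-b) : ℝ) : ℂ) * Complex.I) φ
  set P : L2 d := pφ.toLp 2 with hP
  set Q : L2 d := qφ.toLp 2 with hQ
  set Φ : L2 d := φ.toLp 2 with hΦ
  have hpφ : ∀ᵐ ξ, P ξ =
      (4 * π ^ 2 * ‖ξ‖ ^ 2 : ℝ) * (𝓕 Φ : L2 d) ξ := by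
    rw [hΦ, SchwartzMap.toLp_fourier_eq]
    filter_upwards [pφ.coeFn_toLp 2, (𝓕 φ).coeFn_toLp 2] with ξ h₁ h₂
    rw [h₁, h₂, SchwartzMap.smulLeftCLM_apply_apply hg₃, smul_eq_mul]
  have hqφ : ∀ᵐ x, Q x =
      (2 * π * inner ℝ x (-b) : ℝ) * Complex.I * Φ x := by
    filter_upwards [qφ.coeFn_toLp 2, φ.coeFn_toLp 2] with ξ h₁ h₂
    rw [h₁, h₂, SchwartzMap.smulLeftCLM_apply_apply hg₄, smul_eq_mul]
  -- The left inverse property for `-b`, applied to the test function, is the adjoint form of the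
  -- equation.
  have key := laplaceEvol_generator (neg_ne_zero.2 hb) 1 hpφ hqφ
  have h₁ : inner ℂ f (𝓕 Φ : L2 d) =
      inner ℂ w (P + 𝓕 Q + (1 : ℂ) • 𝓕 Φ) := by
    rw [hw, inner_laplaceEvol_left, map_one, key]
  have h₂ : inner ℂ w P = inner ℂ p (𝓕 Φ : L2 d) := by
    rw [inner_L2_eq, inner_L2_eq]
    apply integral_congr_ae
    filter_upwards [hp, hpφ] with ξ h₁ h₂
    rw [h₁, h₂, map_mul, Complex.conj_ofReal, hFu]
    ring
  have h₃ : inner ℂ u Q = inner ℂ q Φ := by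
    rw [← Lp.inner_fourier_eq u, ← Lp.inner_fourier_eq q, hFu, hFq, inner_sub_left, inner_sub_left,
      h₁, inner_add_right, inner_add_right, h₂, one_smul]
    ring
  have h₄ := congrArg (starRingEnd ℂ) h₃
  rw [inner_conj_symm, inner_conj_symm, inner_L2_eq, inner_L2_eq] at h₄
  refine (Eq.trans ?_ h₄.symm).trans ?_
  · apply integral_congr_ae
    filter_upwards [φ.coeFn_toLp 2] with x h
    rw [h, hφ, Complex.conj_ofReal, Complex.real_smul, mul_comm]
  · apply integral_congr_ae
    filter_upwards [hqφ, φ.coeFn_toLp 2] with x h h'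
    rw [h, h', hφ, inner_neg_right, Complex.real_smul]
    simp only [map_mul, Complex.conj_ofReal, Complex.conj_I]
    push_cast
    ring

/-- The solution `u` for `z = 1` satisfies the equation at `z` with right side `f + (z - 1) 𝓕 u`;
apply the left inverse at `z`. -/
theorem laplaceEvol_resolvent_left {b : Space d} (hb : b ≠ 0) (z : ℂ) (f : L2 d) :
    laplaceEvol hb z f + (z - 1) • laplaceEvol hb z (laplaceEvol hb 1 f) = laplaceEvol hb 1 f := by
  obtain ⟨u, p, q, hu, hp, hq, hf⟩ := exists_generator_laplaceEvol hb f
  have := laplaceEvol_generator hb z hp hq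
  have h : p + 𝓕 q + z • 𝓕 u = f + (z - 1) • 𝓕 u := by
    rw [← hf, sub_smul, one_smul]
    abel
  rwa [h, map_add, map_smul, hu] at this

/-- The adjoint of the left identity for `-b` and the conjugate of `z`. -/
theorem laplaceEvol_resolvent_right {b : Space d} (hb : b ≠ 0) (z : ℂ) (f : L2 d) :
    laplaceEvol hb z f + (z - 1) • laplaceEvol hb 1 (laplaceEvol hb z f) = laplaceEvol hb 1 f := by
  refine ext_inner_right ℂ fun g ↦ ?_
  have h := laplaceEvol_resolvent_left (neg_ne_zero.2 hb) (starRingEnd ℂ z) g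
  rw [inner_add_left, inner_smul_left, inner_laplaceEvol_left hb 1, inner_laplaceEvol_left hb z,
    inner_laplaceEvol_left hb z, inner_laplaceEvol_left hb 1, map_one, ← inner_smul_right,
    ← inner_add_right, map_sub, map_one, h]

/-! ### Invariance transverse to `b` and failure of compactness -/

theorem evol_phase_comm {b w : Space d} (hw : inner ℝ b w = 0) {t : ℝ} (ht : 0 ≤ t) (f : L2 d) :
    evol b t (mulBCF (phase w) f) = mulBCF (phase w) (evol b t f) := by
  apply Lp.ext
  filter_upwards [coeFn_evol b ht (mulBCF (phase w) f), coeFn_evol b ht f,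
    ae_comp_add_right (coeFn_mulBCF (phase w) f) (t • b), coeFn_mulBCF (phase w) (evol b t f)]
    with ξ h₁ h₂ h₃ h₄
  have : phase w (ξ + t • b) = phase w ξ := by
    rw [phase_apply, phase_apply, inner_add_left, real_inner_smul_left, hw, mul_zero, add_zero]
  rw [h₁, h₃, h₄, h₂, this]
  ring

theorem laplaceEvol_phase_comm {b : Space d} (hb : b ≠ 0) {w : Space d} (hw : inner ℝ b w = 0)
    (z : ℂ) (f : L2 d) :
    laplaceEvol hb z (mulBCF (phase w) f) = mulBCF (phase w) (laplaceEvol hb z f) := by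
  rw [laplaceEvol_apply, laplaceEvol_apply,
    ← ContinuousLinearMap.integral_comp_comm _ (integrableOn_exp_smul_evol hb z f)]
  apply setIntegral_congr_fun measurableSet_Ioi
  intro t ht
  simp only
  rw [evol_phase_comm hw (le_of_lt ht), map_smul]

theorem norm_mulBCF_phase (w : Space d) (f : L2 d) : ‖mulBCF (phase w) f‖ = ‖f‖ := by
  apply le_antisymm <;> refine Lp.norm_le_norm_of_ae_le ?_ <;>
  · filter_upwards [coeFn_mulBCF (phase w) f] with x h
    rw [h, norm_mul, norm_phase, one_mul]

/-- High frequency modulations of a fixed function converge weakly to zero. -/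
theorem tendsto_inner_mulBCF_phase {w : Space d} (hw : w ≠ 0) (v h : L2 d) :
    Tendsto (fun n : ℕ ↦ inner ℂ v (mulBCF (phase (n • w)) h)) atTop (𝓝 0) := by
  have hc : Tendsto (fun n : ℕ ↦ n • w) atTop (cocompact (Space d)) := by
    rw [← Metric.cobounded_eq_cocompact, ← tendsto_norm_atTop_iff_cobounded]
    have : ∀ n : ℕ, ‖n • w‖ = n * ‖w‖ := fun n ↦ by
      rw [← Nat.cast_smul_eq_nsmul ℝ, norm_smul, Real.norm_natCast]
    simp_rw [this]
    exact tendsto_natCast_atTop_atTop.atTop_mul_const (norm_pos_iff.2 hw)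
  refine ((tendsto_integral_exp_inner_smul_cocompact
    (fun x ↦ h x * starRingEnd ℂ (v x))).comp hc).congr fun n ↦ ?_
  rw [inner_L2_eq]
  apply integral_congr_ae
  filter_upwards [coeFn_mulBCF (phase (n • w)) h] with x hx
  rw [hx, fourierChar_smul_eq, mul_assoc]

/-- The modulations of `K g` are images of a bounded sequence. A norm limit `y` of a subsequence
would have norm `‖K g‖ ≠ 0`, yet weak convergence to zero forces `⟨y, y⟩ = 0`. -/
theorem not_isCompactOperator_of_phase_comm {w : Space d} (hw : w ≠ 0) {K : L2 d →L[ℂ] L2 d}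
    (hK : ∀ (n : ℕ) f, K (mulBCF (phase (n • w)) f) = mulBCF (phase (n • w)) (K f))
    {g : L2 d} (hg : K g ≠ 0) : ¬ IsCompactOperator K := by
  intro hc
  have hcomp := hc.isCompact_closure_image_closedBall ‖g‖
  have hmem : ∀ n : ℕ, mulBCF (phase (n • w)) (K g) ∈ closure (K '' Metric.closedBall 0 ‖g‖) := by
    intro n
    refine subset_closure ⟨mulBCF (phase (n • w)) g, ?_, hK n g⟩
    rw [mem_closedBall_zero_iff, norm_mulBCF_phase]
  obtain ⟨y, -, φ, hφ, hy⟩ := hcomp.tendsto_subseq hmem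
  have h₁ : ‖y‖ = ‖K g‖ := by
    refine tendsto_nhds_unique hy.norm ?_
    simp only [Function.comp_def, norm_mulBCF_phase]
    exact tendsto_const_nhds
  have h₂ : inner ℂ y y = 0 :=
    tendsto_nhds_unique ((tendsto_const_nhds (x := y)).inner hy)
      ((tendsto_inner_mulBCF_phase hw y (K g)).comp hφ.tendsto_atTop)
  rw [inner_self_eq_zero] at h₂
  rw [h₂, norm_zero, eq_comm, norm_eq_zero] at h₁
  exact hg h₁

/-! ### Back to the Schrödinger operator -/

theorem hasTemperateGrowth_const_mul_norm_sq (c : ℝ) :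
    (fun ξ : Space d ↦ ((c * ‖ξ‖ ^ 2 : ℝ) : ℂ)).HasTemperateGrowth := by fun_prop

theorem fourier_laplacianFun (u : sobolevH2 d) :
    ∀ᵐ ξ, (𝓕 (-laplacianFun u) : L2 d) ξ =
      (4 * π ^ 2 * ‖ξ‖ ^ 2 : ℝ) * (𝓕 (u : L2 d) : L2 d) ξ := by
  have h : TemperedDistribution.smulLeftCLM ℂ (fun ξ : Space d ↦ ((4 * π ^ 2 * ‖ξ‖ ^ 2 : ℝ) : ℂ))
      ((𝓕 (u : L2 d) : L2 d) : 𝓢'(Space d, ℂ)) =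
      ((𝓕 (-laplacianFun u) : L2 d) : 𝓢'(Space d, ℂ)) := by
    have hs : (fun ξ : Space d ↦ ((4 * π ^ 2 * ‖ξ‖ ^ 2 : ℝ) : ℂ)) =
        ((4 * π ^ 2 : ℝ) : ℂ) • fun ξ : Space d ↦ ((‖ξ‖ ^ 2 : ℝ) : ℂ) := by
      ext ξ
      simp
    rw [← Lp.fourier_toTemperedDistribution_eq, ← Lp.fourier_toTemperedDistribution_eq,
      ← Lp.toTemperedDistributionCLM_apply (-laplacianFun u), map_neg,
      Lp.toTemperedDistributionCLM_apply, laplacianFun_spec,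
      TemperedDistribution.laplacian_eq_fourierMultiplierCLM,
      TemperedDistribution.fourierMultiplierCLM_apply, hs,
      TemperedDistribution.smulLeftCLM_smul (by fun_prop), neg_smul, neg_neg,
      ← Complex.coe_smul, fourier_smul, fourier_fourierInv_eq]
    rw [show (2 * π) ^ 2 = 4 * π ^ 2 by ring]
    rfl
  filter_upwards [ae_eq_of_smulLeftCLM_eq (hasTemperateGrowth_const_mul_norm_sq _) h] with ξ hξ
  exact hξ.symm

theorem mem_sobolevH2_of_fourier {u p : L2 d}
    (hp : ∀ᵐ ξ, p ξ = (4 * π ^ 2 * ‖ξ‖ ^ 2 : ℝ) * (𝓕 u : L2 d) ξ) : u ∈ sobolevH2 d := by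
  change TemperedDistribution.MemSobolev 2 2 (u : 𝓢'(Space d, ℂ))
  rw [TemperedDistribution.memSobolev_iff_exists_smulLeftCLM_fourier]
  -- This is `(1 + ‖ξ‖²) 𝓕 u`, the order two Bessel weight applied to `𝓕 u`.
  refine ⟨𝓕 u + ((4 * π ^ 2 : ℝ) : ℂ)⁻¹ • p, ?_⟩
  rw [Lp.fourier_toTemperedDistribution_eq]
  refine smulLeftCLM_eq_of_ae_eq (by fun_prop) ?_
  filter_upwards [hp, Lp.coeFn_add (𝓕 u) (((4 * π ^ 2 : ℝ) : ℂ)⁻¹ • p),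
    Lp.coeFn_smul ((4 * π ^ 2 : ℝ) : ℂ)⁻¹ p] with ξ h₁ h₂ h₃
  have hπ : ((4 * π ^ 2 : ℝ) : ℂ) ≠ 0 := by
    rw [Complex.ofReal_ne_zero]
    positivity
  rw [h₂, Pi.add_apply, h₃, Pi.smul_apply, h₁, div_self two_ne_zero, Real.rpow_one, smul_eq_mul,
    Complex.ofReal_mul (4 * π ^ 2), mul_assoc, inv_mul_cancel_left₀ hπ, Complex.ofReal_add,
    Complex.ofReal_one, add_mul, one_mul]

theorem ae_smul_mulFun (b : Space d) (u : mulDomain fun x : Space d ↦ 2 * π * inner ℝ x b) :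
    ∀ᵐ x, (Complex.I • mulFun _ u : L2 d) x =
      (2 * π * inner ℝ x b : ℝ) * Complex.I * (u : L2 d) x := by
  filter_upwards [mulFun_spec _ u, Lp.coeFn_smul Complex.I (mulFun _ u)] with x h₁ h₂
  rw [h₂, Pi.smul_apply, h₁, smul_eq_mul]
  ring

/-- The inverse of `-Δ + 2πi⟨b, x⟩ + z`. -/
def resolventOp {b : Space d} (hb : b ≠ 0) (z : ℂ) : L2 d →L[ℂ] L2 d :=
  ((Lp.fourierTransformₗᵢ (Space d) ℂ).symm.toContinuousLinearEquiv : L2 d →L[ℂ] L2 d) ∘L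
    laplaceEvol hb z ∘L
    ((Lp.fourierTransformₗᵢ (Space d) ℂ).toContinuousLinearEquiv : L2 d →L[ℂ] L2 d)

theorem resolventOp_apply {b : Space d} (hb : b ≠ 0) (z : ℂ) (f : L2 d) :
    resolventOp hb z f = 𝓕⁻ (laplaceEvol hb z (𝓕 f)) := rfl

theorem isInverseAddOne_resolventOp {b : Space d} (hb : b ≠ 0) :
    IsInverseAddOne (schrodingerOp fun x : Space d ↦ 2 * π * inner ℝ x b) (resolventOp hb 1) := by
  constructor
  · rintro ⟨u, h₁, h₂⟩
    have := laplaceEvol_generator hb 1 (fourier_laplacianFun ⟨u, h₁⟩) (ae_smul_mulFun b ⟨u, h₂⟩)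
    rw [one_smul] at this
    change resolventOp hb 1 (-laplacianFun ⟨u, h₁⟩ + Complex.I • mulFun _ ⟨u, h₂⟩ + u) = u
    rw [resolventOp_apply, FourierTransform.fourier_add, FourierTransform.fourier_add, this,
      fourierInv_fourier_eq]
  · intro f
    obtain ⟨u, p, q, hu, hp, hq, hf⟩ := exists_generator_laplaceEvol hb (𝓕 f)
    have hAf : resolventOp hb 1 f = u := by
      rw [resolventOp_apply, ← hu, fourierInv_fourier_eq]
    have h₁ : u ∈ sobolevH2 d := mem_sobolevH2_of_fourier hp
    have h₂ : u ∈ mulDomain fun x : Space d ↦ 2 * π * inner ℝ x b := by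
      refine ((Lp.memLp q).const_mul (-Complex.I)).ae_eq ?_
      filter_upwards [hq] with x h
      rw [h]
      linear_combination (-((2 * π * inner ℝ x b : ℝ) : ℂ) * u x) * Complex.I_sq
    have hp' : 𝓕 (-laplacianFun ⟨u, h₁⟩) = p := by
      apply Lp.ext
      filter_upwards [hp, fourier_laplacianFun ⟨u, h₁⟩] with ξ h h'
      rw [h, h']
    have hq' : Complex.I • mulFun _ ⟨u, h₂⟩ = q := by
      apply Lp.ext
      filter_upwards [hq, ae_smul_mulFun b ⟨u, h₂⟩] with x h h'
      rw [h, h']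
    simp only [hAf]
    refine ⟨⟨h₁, h₂⟩, ?_⟩
    apply (Lp.fourierTransformₗᵢ (Space d) ℂ).injective
    change 𝓕 (-laplacianFun ⟨u, h₁⟩ + Complex.I • mulFun _ ⟨u, h₂⟩ + u : L2 d) = 𝓕 f
    rw [FourierTransform.fourier_add, FourierTransform.fourier_add, hp', hq', hf]

theorem resolventOp_resolvent_left {b : Space d} (hb : b ≠ 0) (z : ℂ) :
    resolventOp hb z + (z - 1) • (resolventOp hb z * resolventOp hb 1) = resolventOp hb 1 := by
  ext1 f
  change 𝓕⁻ (laplaceEvol hb z (𝓕 f)) + (z - 1) •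
    𝓕⁻ (laplaceEvol hb z (𝓕 (𝓕⁻ (laplaceEvol hb 1 (𝓕 f))))) = 𝓕⁻ (laplaceEvol hb 1 (𝓕 f))
  rw [fourier_fourierInv_eq, ← FourierTransform.fourierInv_smul, ← FourierTransform.fourierInv_add,
    laplaceEvol_resolvent_left]

theorem resolventOp_resolvent_right {b : Space d} (hb : b ≠ 0) (z : ℂ) :
    resolventOp hb z + (z - 1) • (resolventOp hb 1 * resolventOp hb z) = resolventOp hb 1 := by
  ext1 f
  change 𝓕⁻ (laplaceEvol hb z (𝓕 f)) + (z - 1) •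
    𝓕⁻ (laplaceEvol hb 1 (𝓕 (𝓕⁻ (laplaceEvol hb z (𝓕 f))))) = 𝓕⁻ (laplaceEvol hb 1 (𝓕 f))
  rw [fourier_fourierInv_eq, ← FourierTransform.fourierInv_smul, ← FourierTransform.fourierInv_add,
    laplaceEvol_resolvent_right]

/-! ### Spectrum and conclusion -/

/-- If `a = (T + 1)⁻¹` and `c = (T + 1 - l⁻¹)⁻¹`, then `l - a = l (T + 1 - l⁻¹)(T + 1)⁻¹`, whose
inverse is `l⁻¹ + l⁻² c`. -/
theorem isUnit_of_resolvent_identity {R : Type*} [Ring R] [Algebra ℂ R] {a c : R} {l : ℂ}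
    (hl : l ≠ 0) (h₁ : c + -l⁻¹ • (c * a) = a) (h₂ : c + -l⁻¹ • (a * c) = a) :
    IsUnit (algebraMap ℂ R l - a) := by
  have hl' : l * l⁻¹ ^ 2 = l⁻¹ := by field_simp
  rw [neg_smul, ← sub_eq_add_neg] at h₁ h₂
  have e₁ : c - a = l⁻¹ • (c * a) := sub_eq_iff_eq_add.2 (sub_eq_iff_eq_add'.1 h₁)
  have e₂ : c - a = l⁻¹ • (a * c) := sub_eq_iff_eq_add.2 (sub_eq_iff_eq_add'.1 h₂)
  refine ⟨⟨_, l⁻¹ • 1 + l⁻¹ ^ 2 • c, ?_, ?_⟩, rfl⟩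
  · calc _ = (l * l⁻¹) • (1 : R) + (l * l⁻¹ ^ 2) • c - l⁻¹ • a - l⁻¹ ^ 2 • (a * c) := by
          simp only [Algebra.algebraMap_eq_smul_one, sub_mul, mul_add, smul_mul_assoc, one_mul,
            mul_one, mul_smul_comm]
          module
      _ = (1 : R) + l⁻¹ • ((c - a) - l⁻¹ • (a * c)) := by
          rw [mul_inv_cancel₀ hl, hl', one_smul, smul_sub, smul_sub, smul_smul, ← sq]
          abel
      _ = 1 := by rw [e₂, sub_self, smul_zero, add_zero]
  · calc _ = (l⁻¹ * l) • (1 : R) + (l * l⁻¹ ^ 2) • c - l⁻¹ • a - l⁻¹ ^ 2 • (c * a) := by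
          simp only [Algebra.algebraMap_eq_smul_one, mul_sub, add_mul, mul_smul_comm, one_mul,
            mul_one, smul_mul_assoc]
          module
      _ = (1 : R) + l⁻¹ • ((c - a) - l⁻¹ • (c * a)) := by
          rw [inv_mul_cancel₀ hl, hl', one_smul, smul_sub, smul_sub, smul_smul, ← sq]
          abel
      _ = 1 := by rw [e₁, sub_self, smul_zero, add_zero]

theorem exists_L2_ne_zero (d : ℕ) : ∃ f : L2 d, f ≠ 0 := by
  have hfin : volume (Metric.ball (0 : Space d) 1) ≠ ∞ := measure_ball_lt_top.ne
  refine ⟨indicatorConstLp 2 measurableSet_ball hfin 1, ?_⟩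
  rw [← norm_ne_zero_iff, norm_indicatorConstLp (by norm_num) (by norm_num), norm_one, one_mul]
  have : 0 < volume.real (Metric.ball (0 : Space d) 1) :=
    ENNReal.toReal_pos (Metric.measure_ball_pos volume 0 one_pos).ne' hfin
  positivity

theorem laplaceEvol_one_ne_zero {b : Space d} (hb : b ≠ 0) {f : L2 d} (hf : f ≠ 0) :
    laplaceEvol hb 1 f ≠ 0 := by
  intro h
  obtain ⟨u, p, q, hu, hp, hq, h'⟩ := exists_generator_laplaceEvol hb f
  have hu0 : u = 0 := by
    apply (Lp.fourierTransformₗᵢ (Space d) ℂ).injective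
    rw [map_zero]
    exact hu.trans h
  have hz := Lp.coeFn_zero ℂ 2 (volume : Measure (Space d))
  have hp0 : p = 0 := by
    apply Lp.ext
    filter_upwards [hp, hz] with ξ h₁ h₂
    rw [hu, h] at h₁
    rw [h₁, h₂, Pi.zero_apply, mul_zero]
  have hq0 : q = 0 := by
    apply Lp.ext
    filter_upwards [hq, hz] with ξ h₁ h₂
    rw [hu0] at h₁
    rw [h₁, h₂, Pi.zero_apply, mul_zero]
  have hF0 : (𝓕 (0 : L2 d) : L2 d) = 0 := map_zero (Lp.fourierTransformₗᵢ (Space d) ℂ)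
  rw [hp0, hq0, hu0, hF0, add_zero, add_zero] at h'
  exact hf h'.symm

theorem spectrum_resolventOp {b : Space d} (hb : b ≠ 0) :
    spectrum ℂ (resolventOp hb 1) = {0} := by
  obtain ⟨f, hf⟩ := exists_L2_ne_zero d
  have : Nontrivial (L2 d) := ⟨f, 0, hf⟩
  refine (spectrum.nonempty (resolventOp hb 1)).subset_singleton_iff.1 fun l hl ↦ ?_
  by_contra hl0
  have e : 1 - l⁻¹ - 1 = -l⁻¹ := by ring
  refine hl (isUnit_of_resolvent_identity (c := resolventOp hb (1 - l⁻¹)) hl0 ?_ ?_)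
  · rw [← e]
    exact resolventOp_resolvent_left hb _
  · rw [← e]
    exact resolventOp_resolvent_right hb _

theorem not_isCompactOperator_resolventOp {b w : Space d} (hb : b ≠ 0) (hw : w ≠ 0)
    (hbw : inner ℝ b w = 0) : ¬ IsCompactOperator (resolventOp hb 1) := by
  intro h
  obtain ⟨f, hf⟩ := exists_L2_ne_zero d
  refine not_isCompactOperator_of_phase_comm hw (K := laplaceEvol hb 1) (fun n g ↦ ?_)
    (laplaceEvol_one_ne_zero hb hf) ?_
  · refine laplaceEvol_phase_comm hb ?_ 1 g
    rw [← Nat.cast_smul_eq_nsmul ℝ, inner_smul_right, hbw, mul_zero]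
  · have h₁ := (h.comp_clm ((Lp.fourierTransformₗᵢ (Space d) ℂ).symm.toContinuousLinearEquiv :
      L2 d →L[ℂ] L2 d)).clm_comp
      ((Lp.fourierTransformₗᵢ (Space d) ℂ).toContinuousLinearEquiv : L2 d →L[ℂ] L2 d)
    convert! h₁ using 1
    ext1 g
    change laplaceEvol hb 1 g = 𝓕 (resolventOp hb 1 (𝓕⁻ g))
    rw [resolventOp_apply, fourier_fourierInv_eq, fourier_fourierInv_eq]

end BlochTorrey

end

theorem mainTheorem5 (d : ℕ) (hd : 2 ≤ d) (j : ℝ) (hj : j ≠ 0) :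
    ∃ A : BlochTorrey.L2 d →L[ℂ] BlochTorrey.L2 d,
      BlochTorrey.IsInverseAddOne
        (BlochTorrey.schrodingerOp (d := d) (fun x ↦ j * x ⟨0, by omega⟩)) A ∧
      spectrum ℂ A = {0} ∧
      ¬ IsCompactOperator A := by
  set b : BlochTorrey.Space d :=
    EuclideanSpace.single ⟨0, by omega⟩ (j / (2 * Real.pi)) with hbdef
  have hb : b ≠ 0 := by
    rw [hbdef, ne_eq, PiLp.single_eq_zero_iff]
    exact div_ne_zero hj (by positivity)
  have hV : (fun x : BlochTorrey.Space d ↦ j * x ⟨0, by omega⟩) =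
      fun x ↦ 2 * Real.pi * inner ℝ x b := by
    ext x
    rw [hbdef, EuclideanSpace.inner_single_right]
    simp only [Real.ringHom_apply]
    field_simp
  refine ⟨BlochTorrey.resolventOp hb 1, ?_, BlochTorrey.spectrum_resolventOp hb, ?_⟩
  · rw [hV]
    exact BlochTorrey.isInverseAddOne_resolventOp hb
  -- The second basis vector is orthogonal to `b`; this is where `d ≥ 2` is essential.
  · refine BlochTorrey.not_isCompactOperator_resolventOp
      (w := EuclideanSpace.single ⟨1, by omega⟩ 1) hb ?_ ?_
    · rw [ne_eq, PiLp.single_eq_zero_iff]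
      exact one_ne_zero
    · rw [hbdef, EuclideanSpace.inner_single_right]
      simp
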